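/- **Model.** For every $n$, $n$ processors $0,\dots,n-1$ are placed on distinct cells of the grid $\mathbb Z^2$, in the order of a curve $K$ (which may depend on $n$). All processors run the same program, independent of $n$, of $K$ and of the input, in synchronous rounds. Each processor has a constant number of word registers, initially $0$ (a word has $O(\log n)$ bits), and a constant number of slots, initially empty, each holding at most one element of the message set $M$. The program can only move elements of $M$ and combine two of them with a given operation $\circ$; it cannot inspect them. In every round a processor sends at most one packet (one word and at most one element of $M$) on each of a constant number of channels, each to a processor whose number it has computed; it then receives at most one packet per channel and updates its memory by a constant number of arithmetic operations. The *energy* is the sum over all packets of the Manhattan distance between sender and recipient. The *depth* is the maximal length of a chain of packets in which each packet is sent by the recipient of the previous one, in a later round. **Trees.** A rooted tree $T$ with $n$ vertices is stored with one vertex per processor, $v$ in processor $p_v$. Let $s(v)$ be the size of the subtree rooted at $v$. $T$ is in *light-first order* if the children of every vertex $v$ can be indexed $c_1,\dots,c_d$ with $s(c_1)\le\dots\le s(c_d)$ and $p_{c_i}=p_v+1+\sum_{j<i}s(c_j)$ for all $i$. The light-first order for $K$ is *energy-bound* if for every $\Delta$ there is a constant $C_\Delta$ such that, for every tree with $n$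 vertices, each having at most $\Delta$ children, stored in light-first order, the total energy of every vertex sending one message to each of its children along $K$ is at most $C_\Delta n$. **Input.** The processor that stores $v$ initially knows $n$, its own number, the message $m_v\in M$ and, if $v$ is not the root, the processors storing the parent and the left and right siblings of $v$ (if they exist), the index of $v$ among its siblings, and the number of children of its parent. For the root, the index and parent degree are given as $0$, and it has no parent or sibling references. **Theorem.** There are two programs, for *local broadcast* and *local reduce*, such that for every curve $K$ whose light-first order is energy-bound there is a constant $C$ with the following property. Let $T$ be any rooted tree with $n$ vertices (of arbitrary degree) stored in light-first order along $K$, let $M$ be a set with a binary operation $\circ$, and let $m_v\in M$ be the message of the vertex $v$. 1. The local broadcast program halts, and then every vertex $v$ other than the root holds $m_{\mathrm{parent}(v)}$. 2. If $\circ$ is associative, the local reduce program halts, and then every vertex $v$ with children $c_1,\dots,c_d$, $d\ge 1$, holds $m_{c_1}\circ\dots\circ m_{c_d}$, and every leaf holds the empty result. In both cases the execution uses energy at most $C n$, depth at most $C(\lfloor\log_2 n\rfloor+1)$, and at most $C(\lfloor\log_2 n\rfloor+1)$ rounds. Every processor has $O(1)$ memory: all words in registers and packets are at most $(n+1)^C$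 throughout, and no processor ever receives two packets on the same channel in the same round. -/

import Mathlib

namespace SpatialTree

/-! ### Trees stored on a line of processors, light-first order -/

/-- A rooted tree with `n` vertices, one vertex per processor. A vertex is named by the number
of the processor that stores it. `parent` sends the root to itself. -/
structure StoredTree (n : ℕ) where
  root : Fin n
  parent : Fin n → Fin n
  parent_root : parent root = root
  reaches_root : ∀ v, ∃ k : ℕ, parent^[k] v = root

namespace StoredTree

variable {n : ℕ} (T : StoredTree n)

/-- The set of children of `v`. -/
def children (v : Fin n) : Finset (Fin n) :=
  Finset.univ.filter fun c => c ≠ T.root ∧ T.parent c = v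

/-- The children of `v`, listed by increasing storage position. -/
def childList (v : Fin n) : List (Fin n) := (T.children v).sort (· ≤ ·)

open Classical in
/-- The size `s(v)` of the subtree rooted at `v`. -/
noncomputable def subtreeSize (v : Fin n) : ℕ :=
  (Finset.univ.filter fun u : Fin n => ∃ k : ℕ, T.parent^[k] u = v).card

/-- The children `c₁, …, c_d` of `v` have nondecreasing subtree sizes, and `cᵢ` is stored at
position `p_v + 1 + ∑_{j < i} s(cⱼ)`. (These positions increase with `i`, so listing
the children by position is the only indexing for which this can hold.) -/
def NeighborhoodLightFirst (v : Fin n) : Prop :=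
  (T.childList v).Pairwise (fun c c' => T.subtreeSize c ≤ T.subtreeSize c') ∧
  ∀ (i : ℕ) (hi : i < (T.childList v).length),
    ((T.childList v)[i] : ℕ) = v + 1 + (((T.childList v).take i).map T.subtreeSize).sum

/-- The tree is stored in light-first order. -/
def LightFirst : Prop := ∀ v, T.NeighborhoodLightFirst v

/-- The zero-based index of a non-root vertex among its siblings. -/
def childIndex (v : Fin n) : ℕ := (T.childList (T.parent v)).idxOf v

end StoredTree

/-! ### The grid -/

/-- For each `n`, a sequence of `n` distinct cells of the planar grid. The `i`-th of `n`
processors is located at `pos n i`. A single infinite curve is the case in which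
`pos n i` does not depend on `n`. -/
structure Curve where
  pos : (n : ℕ) → Fin n → ℤ × ℤ
  injective : ∀ n, Function.Injective (pos n)

/-- The energy of a message from processor `i` to processor `j`: their Manhattan distance. -/
def Curve.dist (K : Curve) {n : ℕ} (i j : Fin n) : ℕ :=
  ((K.pos n i).1 - (K.pos n j).1).natAbs + ((K.pos n i).2 - (K.pos n j).2).natAbs

/-- The light-first order for `K` is energy-bound: for trees of bounded degree stored in this
order, the total energy of each vertex sending one message to each of its children
is `O(n)`, with a constant that may depend on the degree bound. -/
def Curve.EnergyBound (K : Curve) : Prop :=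
  ∀ Δ : ℕ, ∃ C : ℕ, ∀ (n : ℕ) (T : StoredTree n), T.LightFirst →
    (∀ v, (T.children v).card ≤ Δ) →
    ∑ v : Fin n, ∑ c ∈ T.children v, K.dist v c ≤ C * n

/-! ### Programs

All processors run the same program, in synchronous rounds. A processor has a fixed number of
word registers and of message slots. A word is a natural number; a slot is empty or
holds one element of the type `M` of tree messages. The program cannot inspect elements of `M`:
it can only move them and combine two of them with the given operation.
In each round, a processor sends at most one packet per channel (one word and at most one
element of `M`), then receives at most one packet per channel, then updates its registers,
each of these by a fixed number of arithmetic operations. -/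

/-- The read-only input words of a processor. -/
inductive Input
  /-- the number of processors -/
  | size
  /-- the processor's own number -/
  | self
  /-- reference to the parent of the stored vertex -/
  | parent
  /-- one-based index of the vertex among its siblings -/
  | index
  /-- number of children of the parent -/
  | degree
  /-- reference to the left sibling -/
  | left
  /-- reference to the right sibling -/
  | right

/-- Arithmetic expressions over words, with `r` registers and `c` channels. -/
inductive WordExpr (r c : ℕ)
  | const (a : ℕ)
  | input (f : Input)
  | reg (i : Fin r)
  /-- the word of the packet just received on a channel, `0` if there is none -/
  | recv (ch : Fin c)
  /-- `1` if a packet was just received on a channel, `0` otherwise -/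
  | arrived (ch : Fin c)
  | add (a b : WordExpr r c)
  | sub (a b : WordExpr r c)
  | mul (a b : WordExpr r c)
  | div (a b : WordExpr r c)
  | mod (a b : WordExpr r c)
  /-- `if a ≤ b then x else y` -/
  | ifLe (a b x y : WordExpr r c)

/-- Where an element of `M` can be read from. -/
inductive Source (s c : ℕ)
  /-- the processor's own tree message (read-only input) -/
  | own
  | slot (i : Fin s)
  /-- the content of the packet just received on a channel -/
  | recv (ch : Fin c)

/-- A list of guarded sources. Its value is the combination, from left to right, of the
nonempty sources whose guard is nonzero. -/
abbrev SlotExpr (r s c : ℕ) := List (WordExpr r c × Source s c)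

/-- A program. Nothing in it depends on the number of processors or on the tree. -/
structure Program where
  regs : ℕ
  slots : ℕ
  channels : ℕ
  /-- the number of the recipient; a value that is not the number of a processor means that
  nothing is sent on this channel -/
  target : Fin channels → WordExpr regs channels
  /-- the word sent -/
  word : Fin channels → WordExpr regs channels
  /-- the element of `M` sent -/
  content : Fin channels → SlotExpr regs slots channels
  /-- the new register values -/
  nextReg : Fin regs → WordExpr regs channels
  /-- the new slot values -/
  nextSlot : Fin slots → SlotExpr regs slots channels
  /-- the slot that holds the output -/
  out : Fin slots

/-! ### Semantics -/

/-- A word, and at most one element of `M`. -/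
structure Packet (M : Type*) where
  word : ℕ
  content : Option M

/-- What a processor sees when it evaluates expressions. -/
structure Env (r s c : ℕ) (M : Type*) where
  input : Input → ℕ
  own : M
  reg : Fin r → ℕ
  slot : Fin s → Option M
  inbox : Fin c → Option (Packet M)

def WordExpr.eval {r s c : ℕ} {M : Type*} (e : Env r s c M) : WordExpr r c → ℕ
  | const a => a
  | input f => e.input f
  | reg i => e.reg i
  | recv ch => ((e.inbox ch).map Packet.word).getD 0
  | arrived ch => if (e.inbox ch).isSome then 1 else 0
  | add a b => a.eval e + b.eval e
  | sub a b => a.eval e - b.eval e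
  | mul a b => a.eval e * b.eval e
  | div a b => a.eval e / b.eval e
  | mod a b => a.eval e % b.eval e
  | ifLe a b x y => if a.eval e ≤ b.eval e then x.eval e else y.eval e

def Source.eval {r s c : ℕ} {M : Type*} (e : Env r s c M) : Source s c → Option M
  | own => some e.own
  | slot i => e.slot i
  | recv ch => (e.inbox ch).bind Packet.content

/-- Combination of a list from left to right, skipping empty entries; `none` if there is
nothing to combine. -/
def combineList {M : Type*} (op : M → M → M) (l : List (Option M)) : Option M :=
  l.foldl (Option.merge op) none

def SlotExpr.eval {r s c : ℕ} {M : Type*} (op : M → M → M) (e : Env r s c M)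
    (x : SlotExpr r s c) : Option M :=
  combineList op (x.map fun g => if g.1.eval e = 0 then none else g.2.eval e)

/-- A reference as a word; the absent reference is written as `n`. -/
def refWord {n : ℕ} : Option (Fin n) → ℕ
  | some p => p
  | none => n

/-- The input words of the processor that stores `v`. The root has no parent and no siblings;
its index and parent degree are `0`. -/
def StoredTree.input {n : ℕ} (T : StoredTree n) (v : Fin n) : Input → ℕ
  | .size => n
  | .self => v
  | .parent => if v = T.root then n else T.parent v
  | .index => if v = T.root then 0 else T.childIndex v + 1
  | .degree => if v = T.root then 0 else (T.childList (T.parent v)).length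
  | .left => if v = T.root ∨ T.childIndex v = 0 then n
      else refWord (T.childList (T.parent v))[T.childIndex v - 1]?
  | .right => if v = T.root then n
      else refWord (T.childList (T.parent v))[T.childIndex v + 1]?

/-- The memory contents of one processor. -/
@[ext] structure Mem (P : Program) (M : Type*) where
  reg : Fin P.regs → ℕ
  slot : Fin P.slots → Option M

section Execution

variable {n : ℕ} (P : Program) (T : StoredTree n) {M : Type*} (op : M → M → M) (m : Fin n → M)

/-- The environment of processor `p` before it receives anything in the current round. -/
def sendEnv (σ : Fin n → Mem P M) (p : Fin n) : Env P.regs P.slots P.channels M :=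
  ⟨T.input p, m p, (σ p).reg, (σ p).slot, fun _ => none⟩

/-- The recipient of the packet that `p` sends on channel `ch`, if it sends one. -/
def recipient (σ : Fin n → Mem P M) (p : Fin n) (ch : Fin P.channels) : Option (Fin n) :=
  let w := (P.target ch).eval (sendEnv P T m σ p)
  if h : w < n then some ⟨w, h⟩ else none

/-- The packet that `p` sends on channel `ch`, if it sends one. -/
def packet (σ : Fin n → Mem P M) (p : Fin n) (ch : Fin P.channels) : Packet M :=
  ⟨(P.word ch).eval (sendEnv P T m σ p), (P.content ch).eval op (sendEnv P T m σ p)⟩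

/-- The packet received by `q` on channel `ch`. (Executions in which two packets arrive at once
on the same channel are not admitted below.) -/
def inbox (σ : Fin n → Mem P M) (q : Fin n) (ch : Fin P.channels) : Option (Packet M) :=
  ((List.finRange n).find? fun p => recipient P T m σ p ch = some q).map
    fun p => packet P T op m σ p ch

/-- One round. -/
def round (σ : Fin n → Mem P M) (q : Fin n) : Mem P M :=
  let e : Env P.regs P.slots P.channels M :=
    ⟨T.input q, m q, (σ q).reg, (σ q).slot, inbox P T op m σ q⟩
  ⟨fun i => (P.nextReg i).eval e, fun i => (P.nextSlot i).eval op e⟩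

/-- The memory of all processors after `t` rounds. Initially registers are `0` and slots are
empty. -/
def state : ℕ → Fin n → Mem P M
  | 0 => fun _ => ⟨fun _ => 0, fun _ => none⟩
  | t + 1 => round P T op m (state t)

/-- In round `t` (counted from `0`), `p` sends a packet to `q` on channel `ch`. -/
def Sends (t : ℕ) (p : Fin n) (ch : Fin P.channels) (q : Fin n) : Prop :=
  recipient P T m (state P T op m t) p ch = some q

instance (t : ℕ) (p : Fin n) (ch : Fin P.channels) (q : Fin n) :
    Decidable (Sends P T op m t p ch q) :=
  inferInstanceAs (Decidable (_ = _))

/-- The total energy of the first `t` rounds: the sum over all packets of the distance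
travelled. -/
def energy (K : Curve) (t : ℕ) : ℕ :=
  ∑ i ∈ Finset.range t, ∑ p : Fin n, ∑ ch : Fin P.channels, ∑ q : Fin n,
    if Sends P T op m i p ch q then K.dist p q else 0

/-- The length of the longest chain of dependent packets that ends at `q` within the first `t`
rounds. In a chain, each packet is sent by the recipient of the previous packet, in
a later round. -/
def chainLength : ℕ → Fin n → ℕ
  | 0, _ => 0
  | t + 1, q => max (chainLength t q) (Finset.univ.sup fun p : Fin n =>
      if ∃ ch, Sends P T op m t p ch q then chainLength t p + 1 else 0)

/-- The depth of the first `t` rounds: the length of the longest chain of dependent packets. -/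
def depth (t : ℕ) : ℕ := Finset.univ.sup (chainLength P T op m t)

/-- The content of the output slot of `v` after `t` rounds. -/
def output (t : ℕ) (v : Fin n) : Option M := (state P T op m t v).slot P.out

/-- The execution halts after `t` rounds, and up to then it satisfies, with the constant `C`:
energy `O(n)`, depth `O(log n)` (and even `O(log n)` rounds), and `O(log n)` bits for
every word in memory or in a packet. -/
structure HaltsWithin (K : Curve) (C t : ℕ) : Prop where
  /-- no processor receives two packets on the same channel in the same round -/
  no_collision : ∀ i < t, ∀ p p' ch q,
    Sends P T op m i p ch q → Sends P T op m i p' ch q → p = p'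
  /-- after `t` rounds nothing is sent and the memory does not change any more -/
  silent : ∀ p ch q, ¬ Sends P T op m t p ch q
  stable : state P T op m (t + 1) = state P T op m t
  energy_le : energy P T op m K t ≤ C * n
  depth_le : depth P T op m t ≤ C * (Nat.log 2 n + 1)
  rounds_le : t ≤ C * (Nat.log 2 n + 1)
  reg_le : ∀ i ≤ t, ∀ p r, (state P T op m i p).reg r ≤ (n + 1) ^ C
  word_le : ∀ i < t, ∀ p ch q, Sends P T op m i p ch q →
    (packet P T op m (state P T op m i) p ch).word ≤ (n + 1) ^ C

end Execution

/-- The result of a local reduce at `v`: the combination of the messages of the children of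
`v`, in their order; `none` if `v` is a leaf. -/
def StoredTree.localReduce {n : ℕ} (T : StoredTree n) {M : Type*} (op : M → M → M)
    (m : Fin n → M) (v : Fin n) : Option M :=
  combineList op ((T.childList v).map fun c => some (m c))

end SpatialTree

/-! Degrees are arbitrary, so messages travel along a virtual tree on the same processors in which
every vertex has at most three children. Each list of siblings is halved recursively: the first
sibling of a block is its root, and the rest is cut into a left part and a right part whose lengths
differ by at most one. The virtual children of `v` are its first child in `T`, which is the root of
the whole list of children, and the roots of the two parts of the block of `v`.

Energy: no vertex moves, and the virtual tree is again in light-first order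
(`virtualTree_lightFirst`). Below the first child hang `s(v) - 1` vertices; a nonempty part of the
block of `v` contains a later, hence no lighter, sibling, so it weighs at least `s(v)`; the right
part is no shorter than the left one and its members are no lighter. The positions follow because
subtrees of consecutive siblings are adjacent. Hence the energy bound for degree 3 makes one message
per virtual edge cost `O(n)`.

Distribution: a vertex finds the length and depth of its block from its index and the number of its
siblings, but it has no reference to the root of the right part. Blocks are therefore completed from
the deepest level upwards, and a completed block knows the sibling that follows it. The reply of the
left part thus names the root of the right part, and the reply of the right part names the sibling
after the whole block. Replies also carry the combined messages, so the first child ends up with the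
local reduce. Its report tells the parent where the first child is, and the broadcast then runs down
the virtual tree level by level. Blocks have logarithmic depth, and each level takes a constant
number of rounds.

Correctness is the invariant `Inv`, preserved by `Inv.round`. It determines the packets sent
(`Inv.recipient_iff`), and `Comm.time_unique` shows that each virtual edge is used at most once per
channel and direction, as `energy_le_of_kids` requires. -/

namespace SpatialTree

/-! ### Recursive halving of a list of siblings

The block of `r` consecutive siblings that starts at position `a` has `a` as its root; the
remaining `r - 1` siblings are split into a left block of `(r - 1) / 2` siblings and
a right block of `r / 2` siblings. -/

/-- One step of the search for the block rooted at a given position. A triple `(o, r, e)` stands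
for the position with offset `o` in a block of `r` siblings at depth `e`. -/
def descend (x : ℕ × ℕ × ℕ) : ℕ × ℕ × ℕ :=
  if x.1 = 0 then x
  else if x.1 - 1 < (x.2.1 - 1) / 2 then (x.1 - 1, (x.2.1 - 1) / 2, x.2.2 + 1)
  else (x.1 - 1 - (x.2.1 - 1) / 2, x.2.1 / 2, x.2.2 + 1)

/-- `Block d a r e`: in a list of `d` siblings, the block rooted at position `a` has `r`
elements and depth `e`. -/
inductive Block (d : ℕ) : ℕ → ℕ → ℕ → Prop
  | whole (h : 1 ≤ d) : Block d 0 d 0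
  | left {a r e : ℕ} (h : Block d a r e) (hr : 3 ≤ r) : Block d (a + 1) ((r - 1) / 2) (e + 1)
  | right {a r e : ℕ} (h : Block d a r e) (hr : 2 ≤ r) :
      Block d (a + 1 + (r - 1) / 2) (r / 2) (e + 1)

namespace Block

variable {d a r e : ℕ}

theorem one_le (h : Block d a r e) : 1 ≤ r := by
  cases h <;> omega

theorem add_le (h : Block d a r e) : a + r ≤ d := by
  induction h <;> omega

/-- Both parts of a block have at most half its length. This is the source of every logarithm in the
bounds. -/
theorem two_pow_mul_le (h : Block d a r e) : 2 ^ e * r ≤ d := by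
  induction h with
  | whole h => simp
  | @left a r e h hr ih =>
    refine le_trans ?_ ih
    rw [pow_succ, mul_assoc]
    exact Nat.mul_le_mul_left _ (by omega)
  | @right a r e h hr ih =>
    refine le_trans ?_ ih
    rw [pow_succ, mul_assoc]
    exact Nat.mul_le_mul_left _ (by omega)

theorem two_pow_le (h : Block d a r e) : 2 ^ e ≤ d :=
  le_trans (Nat.le_mul_of_pos_right _ h.one_le) h.two_pow_mul_le

/-- The search passes down one level per step, always into the part containing the position, so it
traces the derivation of the block. -/
theorem descend_iterate (h : Block d a r e) {x : ℕ} (hx : x < r) :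
    descend^[e] (a + x, d, 0) = (x, r, e) := by
  induction h generalizing x with
  | whole h => simp
  | @left a r e h hr ih =>
    rw [Function.iterate_succ_apply', add_assoc, ih (by omega)]
    simp only [descend]
    rw [if_neg (by omega), if_pos (by omega)]
    simp
  | @right a r e h hr ih =>
    have : a + 1 + (r - 1) / 2 + x = a + (1 + (r - 1) / 2 + x) := by ring
    rw [Function.iterate_succ_apply', this, ih (by omega)]
    simp only [descend]
    rw [if_neg (by omega), if_neg (by omega)]
    simp only [Prod.mk.injEq, and_true]
    omega

/-- States with offset `0` are fixed points, so all processors may iterate equally long without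
knowing when their own search ends. -/
theorem descend_iterate_of_le (h : Block d a r e) {k : ℕ} (hk : e ≤ k) :
    descend^[k] (a, d, 0) = (0, r, e) := by
  obtain ⟨j, rfl⟩ := Nat.exists_eq_add_of_le' hk
  have h0 := h.descend_iterate h.one_le
  rw [add_zero] at h0
  rw [Function.iterate_add_apply, h0]
  exact Function.iterate_fixed (by simp [descend]) j

end Block

/-- The invariant of the search. For `k = d` the alternative `e = k` is impossible, since depths are
less than `d`; hence every position is the root of a block. -/
theorem exists_block_descend {d j : ℕ} (hj : j < d) (k : ℕ) :
    ∃ x r e, descend^[k] (j, d, 0) = (x, r, e) ∧ x < r ∧ x ≤ j ∧ Block d (j - x) r e ∧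
      (x = 0 ∨ e = k) := by
  induction k with
  | zero => exact ⟨j, d, 0, rfl, hj, le_rfl, by simpa using Block.whole (by omega), Or.inr rfl⟩
  | succ k ih =>
    obtain ⟨x, r, e, h1, h2, h3, h4, h5⟩ := ih
    rw [Function.iterate_succ_apply', h1]
    simp only [descend]
    by_cases hx : x = 0
    · exact ⟨x, r, e, by rw [if_pos hx], h2, h3, h4, Or.inl hx⟩
    · rw [if_neg hx]
      have he : e = k := by tauto
      by_cases hl : x - 1 < (r - 1) / 2
      · refine ⟨x - 1, (r - 1) / 2, e + 1, by rw [if_pos hl], by omega, by omega, ?_, by omega⟩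
        have := h4.left (by omega)
        rwa [show j - x + 1 = j - (x - 1) by omega] at this
      · refine ⟨x - 1 - (r - 1) / 2, r / 2, e + 1, by rw [if_neg hl], by omega, by omega, ?_,
          by omega⟩
        have := h4.right (by omega)
        rwa [show j - x + 1 + (r - 1) / 2 = j - (x - 1 - (r - 1) / 2) by omega] at this

/-- The number of elements of the block rooted at position `j`. -/
def blockLen (d j : ℕ) : ℕ := (descend^[d] (j, d, 0)).2.1

/-- The depth of the block rooted at position `j`. -/
def blockDepth (d j : ℕ) : ℕ := (descend^[d] (j, d, 0)).2.2

theorem Block.depth_lt {d a r e : ℕ} (h : Block d a r e) : e < d :=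
  lt_of_lt_of_le e.lt_two_pow_self h.two_pow_le

theorem Block.blockLen_eq {d a r e : ℕ} (h : Block d a r e) : blockLen d a = r := by
  rw [blockLen, h.descend_iterate_of_le h.depth_lt.le]

theorem Block.blockDepth_eq {d a r e : ℕ} (h : Block d a r e) : blockDepth d a = e := by
  rw [blockDepth, h.descend_iterate_of_le h.depth_lt.le]

theorem block_blockLen {d j : ℕ} (hj : j < d) : Block d j (blockLen d j) (blockDepth d j) := by
  obtain ⟨x, r, e, h1, h2, h3, h4, h5⟩ := exists_block_descend hj d
  have hx : x = 0 := h5.resolve_right h4.depth_lt.ne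
  subst hx
  simpa [blockLen, blockDepth, h1] using h4

/-- The two ways in which a position other than `0` is a child of another position. -/
theorem exists_block_parent {d j : ℕ} (hj : j < d) (h0 : j ≠ 0) :
    ∃ a < d, (3 ≤ blockLen d a ∧ j = a + 1) ∨
      (2 ≤ blockLen d a ∧ j = a + 1 + (blockLen d a - 1) / 2) := by
  have h := block_blockLen hj
  generalize blockLen d j = r, blockDepth d j = e at h
  cases h with
  | whole h => exact absurd rfl h0
  | @left a r e h hr =>
    refine ⟨a, by omega, Or.inl ⟨?_, rfl⟩⟩
    rwa [h.blockLen_eq]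
  | @right a r e h hr =>
    refine ⟨a, by omega, Or.inr ⟨?_, ?_⟩⟩ <;> rw [h.blockLen_eq]
    exact hr

/-- Blocks of the same depth that share an element are equal. -/
theorem Block.eq_of_mem {d a r a' r' e j : ℕ} (h : Block d a r e) (h' : Block d a' r' e)
    (hj : a ≤ j) (hj' : j < a + r) (hk : a' ≤ j) (hk' : j < a' + r') : a = a' ∧ r = r' := by
  have h1 := h.descend_iterate (x := j - a) (by omega)
  have h2 := h'.descend_iterate (x := j - a') (by omega)
  rw [show a + (j - a) = j by omega] at h1
  rw [show a' + (j - a') = j by omega, h1] at h2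
  simp only [Prod.mk.injEq] at h2
  omega

end SpatialTree

namespace SpatialTree
namespace StoredTree

variable {n : ℕ} (T : StoredTree n)

/-! ### Siblings -/

theorem mem_children {v c : Fin n} : c ∈ T.children v ↔ c ≠ T.root ∧ T.parent c = v := by
  simp [children]

theorem mem_childList {v c : Fin n} : c ∈ T.childList v ↔ c ≠ T.root ∧ T.parent c = v := by
  simp [childList, mem_children]

theorem nodup_childList (v : Fin n) : (T.childList v).Nodup := Finset.sort_nodup _ _

/-- The list of siblings of `v`, including `v`. The root is its own only sibling. -/
def sibs (v : Fin n) : List (Fin n) :=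
  if v = T.root then [T.root] else T.childList (T.parent v)

/-- The position of `v` among its siblings. -/
def idx (v : Fin n) : ℕ := (T.sibs v).idxOf v

/-- The number of siblings in the block rooted at `v`. -/
def len (v : Fin n) : ℕ := blockLen (T.sibs v).length (T.idx v)

/-- The depth of the block rooted at `v`. -/
def dep (v : Fin n) : ℕ := blockDepth (T.sibs v).length (T.idx v)

theorem mem_sibs_self (v : Fin n) : v ∈ T.sibs v := by
  unfold sibs
  split_ifs with h
  · simp [h]
  · exact T.mem_childList.2 ⟨h, rfl⟩

theorem nodup_sibs (v : Fin n) : (T.sibs v).Nodup := by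
  unfold sibs
  split_ifs with h
  · simp
  · exact T.nodup_childList _

theorem sibs_eq_of_mem {u v : Fin n} (h : u ∈ T.sibs v) : T.sibs u = T.sibs v := by
  unfold sibs at h ⊢
  by_cases hv : v = T.root
  · simp only [hv, if_true, List.mem_singleton] at h ⊢
    simp [h]
  · simp only [hv, if_false] at h ⊢
    rw [mem_childList] at h
    rw [if_neg h.1, h.2]

theorem idx_lt (v : Fin n) : T.idx v < (T.sibs v).length :=
  List.idxOf_lt_length_of_mem (T.mem_sibs_self v)

theorem getElem?_idx (v : Fin n) : (T.sibs v)[T.idx v]? = some v := by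
  rw [List.getElem?_eq_getElem (T.idx_lt v)]
  simp [idx]

theorem block_len (v : Fin n) : Block (T.sibs v).length (T.idx v) (T.len v) (T.dep v) :=
  block_blockLen (T.idx_lt v)

variable {T} in
theorem idx_eq_of_getElem? {u v : Fin n} {i : ℕ} (h : (T.sibs v)[i]? = some u) :
    T.sibs u = T.sibs v ∧ T.idx u = i := by
  have h1 := T.sibs_eq_of_mem (List.mem_of_getElem? h)
  refine ⟨h1, ?_⟩
  obtain ⟨hi, rfl⟩ := List.getElem?_eq_some_iff.1 h
  rw [idx, h1]
  exact (T.nodup_sibs v).idxOf_getElem i hi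

/-! ### The virtual tree -/

/-- The first child of `v`. -/
def firstChild (v : Fin n) : Option (Fin n) := (T.childList v)[0]?

/-- The root of the left part of the block rooted at `v`. -/
def leftChild (v : Fin n) : Option (Fin n) :=
  if 3 ≤ T.len v then (T.sibs v)[T.idx v + 1]? else none

/-- The root of the right part of the block rooted at `v`. -/
def rightChild (v : Fin n) : Option (Fin n) :=
  if 2 ≤ T.len v then (T.sibs v)[T.idx v + 1 + (T.len v - 1) / 2]? else none

variable {T} in
theorem leftChild_spec {p q : Fin n} (h : T.leftChild p = some q) :
    3 ≤ T.len p ∧ T.sibs q = T.sibs p ∧ T.idx q = T.idx p + 1 ∧ T.len q = (T.len p - 1) / 2 ∧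
      T.dep q = T.dep p + 1 := by
  unfold leftChild at h
  split_ifs at h with hp
  obtain ⟨h1, h2⟩ := idx_eq_of_getElem? h
  have hb := (T.block_len p).left hp
  refine ⟨hp, h1, h2, ?_, ?_⟩
  · rw [len, h1, h2, hb.blockLen_eq]
  · rw [dep, h1, h2, hb.blockDepth_eq]

variable {T} in
theorem rightChild_spec {p q : Fin n} (h : T.rightChild p = some q) :
    2 ≤ T.len p ∧ T.sibs q = T.sibs p ∧ T.idx q = T.idx p + 1 + (T.len p - 1) / 2 ∧
      T.len q = T.len p / 2 ∧ T.dep q = T.dep p + 1 := by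
  unfold rightChild at h
  split_ifs at h with hp
  obtain ⟨h1, h2⟩ := idx_eq_of_getElem? h
  have hb := (T.block_len p).right hp
  refine ⟨hp, h1, h2, ?_, ?_⟩
  · rw [len, h1, h2, hb.blockLen_eq]
  · rw [dep, h1, h2, hb.blockDepth_eq]

variable {T} in
theorem firstChild_spec {p q : Fin n} (h : T.firstChild p = some q) :
    q ≠ T.root ∧ T.parent q = p ∧ T.idx q = 0 ∧ T.dep q = 0 ∧ T.len q = (T.sibs q).length := by
  have hq := T.mem_childList.1 (List.mem_of_getElem? h)
  have hs : T.sibs q = T.childList p := by rw [sibs, if_neg hq.1, hq.2]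
  have h0 : T.idx q = 0 := (idx_eq_of_getElem? (T := T) (v := q) (by rw [hs]; exact h)).2
  have hb := Block.whole (d := (T.sibs q).length) (by have := T.idx_lt q; omega)
  exact ⟨hq.1, hq.2, h0, by rw [dep, h0, hb.blockDepth_eq], by rw [len, h0, hb.blockLen_eq]⟩

theorem firstChild_parent {q : Fin n} (hq : q ≠ T.root) (h0 : T.idx q = 0) :
    T.firstChild (T.parent q) = some q := by
  have h := T.getElem?_idx q
  rwa [h0, sibs, if_neg hq] at h

theorem exists_leftChild {p : Fin n} (h : 3 ≤ T.len p) : ∃ q, T.leftChild p = some q := by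
  have := ((T.block_len p).left h).add_le
  rw [leftChild, if_pos h, List.getElem?_eq_getElem (by omega)]
  exact ⟨_, rfl⟩

theorem exists_rightChild {p : Fin n} (h : 2 ≤ T.len p) : ∃ q, T.rightChild p = some q := by
  have := ((T.block_len p).right h).add_le
  rw [rightChild, if_pos h, List.getElem?_eq_getElem (by omega)]
  exact ⟨_, rfl⟩

/-- The children of `v` in the virtual tree, by increasing position. -/
def kids (v : Fin n) : List (Fin n) :=
  (T.firstChild v).toList ++ ((T.leftChild v).toList ++ (T.rightChild v).toList)

theorem mem_kids {p q : Fin n} : q ∈ T.kids p ↔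
    T.firstChild p = some q ∨ T.leftChild p = some q ∨ T.rightChild p = some q := by
  simp [kids]

theorem exists_mem_kids {q : Fin n} (hq : q ≠ T.root) : ∃ p, q ∈ T.kids p := by
  by_cases h0 : T.idx q = 0
  · exact ⟨_, T.mem_kids.2 (Or.inl (T.firstChild_parent hq h0))⟩
  · obtain ⟨a, ha, h⟩ := exists_block_parent (T.idx_lt q) h0
    have hp : (T.sibs q)[a]? = some (T.sibs q)[a] := List.getElem?_eq_getElem ha
    obtain ⟨h1, h2⟩ := idx_eq_of_getElem? hp
    refine ⟨(T.sibs q)[a], T.mem_kids.2 (Or.inr ?_)⟩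
    have hq' := T.getElem?_idx q
    rcases h with ⟨h, e⟩ | ⟨h, e⟩
    · left
      rw [leftChild, if_pos (by rwa [len, h1, h2]), h1, h2, ← e, hq']
    · right
      rw [rightChild, if_pos (by rwa [len, h1, h2]), len, h1, h2, ← e, hq']

theorem ne_root_of_mem_kids {p q : Fin n} (h : q ∈ T.kids p) : q ≠ T.root := by
  -- The sibling list of the root has a single position, so nothing in it can follow another
  -- element.
  have key : ∀ {i}, T.sibs q = T.sibs p → T.idx q = i → T.idx p < i → q ≠ T.root := by
    rintro i hs hi hlt rfl
    have := T.idx_lt p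
    have h1 := T.idx_lt T.root
    rw [← hs] at this
    rw [sibs, if_pos rfl] at this h1
    simp only [List.length_singleton] at this h1
    omega
  rcases T.mem_kids.1 h with h | h | h
  · exact (firstChild_spec h).1
  · obtain ⟨-, h1, h2, -⟩ := leftChild_spec h
    exact key h1 h2 (by omega)
  · obtain ⟨-, h1, h2, -⟩ := rightChild_spec h
    exact key h1 h2 (by omega)

theorem eq_of_idx_eq {u v : Fin n} (hs : T.sibs u = T.sibs v) (hi : T.idx u = T.idx v) :
    u = v := by
  have h := T.getElem?_idx u
  rw [hs, hi, T.getElem?_idx v] at h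
  exact (Option.some.inj h).symm

/-! ### Uniqueness of the virtual parent -/

variable {T}

theorem firstChild_inj {p p' q : Fin n} (h : T.firstChild p = some q)
    (h' : T.firstChild p' = some q) : p = p' := by
  rw [← (firstChild_spec h).2.1, (firstChild_spec h').2.1]

theorem leftChild_inj {p p' q : Fin n} (h : T.leftChild p = some q)
    (h' : T.leftChild p' = some q) : p = p' := by
  obtain ⟨-, h1, h2, -⟩ := leftChild_spec h
  obtain ⟨-, h1', h2', -⟩ := leftChild_spec h'
  exact T.eq_of_idx_eq (h1.symm.trans h1') (by omega)

theorem firstChild_ne_leftChild {p p' q : Fin n} (h : T.firstChild p = some q)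
    (h' : T.leftChild p' = some q) : False := by
  have h1 := (firstChild_spec h).2.2.1
  have h2 := (leftChild_spec h').2.2.1
  omega

theorem firstChild_ne_rightChild {p p' q : Fin n} (h : T.firstChild p = some q)
    (h' : T.rightChild p' = some q) : False := by
  have h1 := (firstChild_spec h).2.2.1
  have h2 := (rightChild_spec h').2.2.1
  omega

/-- Two siblings of the same depth with blocks that contain a common element are equal. -/
theorem eq_of_block_mem {p p' q : Fin n} (hs : T.sibs q = T.sibs p) (hs' : T.sibs q = T.sibs p')
    (he : T.dep p = T.dep p') (h1 : T.idx p ≤ T.idx q) (h2 : T.idx q < T.idx p + T.len p)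
    (h1' : T.idx p' ≤ T.idx q) (h2' : T.idx q < T.idx p' + T.len p') : p = p' := by
  have hss := hs.symm.trans hs'
  have hb := T.block_len p
  have hb' := T.block_len p'
  rw [hss, he] at hb
  exact T.eq_of_idx_eq hss (hb.eq_of_mem hb' h1 h2 h1' h2').1

/-- The position of a right child depends on the block length, so positions alone do not give `p`.
But `p` and `p'` have equal depth and both of their blocks contain `q`. -/
theorem rightChild_inj {p p' q : Fin n} (h : T.rightChild p = some q)
    (h' : T.rightChild p' = some q) : p = p' := by
  obtain ⟨h0, h1, h2, -, h3⟩ := rightChild_spec h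
  obtain ⟨h0', h1', h2', -, h3'⟩ := rightChild_spec h'
  exact eq_of_block_mem h1 h1' (by omega) (by omega) (by omega) (by omega) (by omega)

/-- As for two right children, the parents must coincide; then the nonempty left part separates the
two positions. -/
theorem leftChild_ne_rightChild {p p' q : Fin n} (h : T.leftChild p = some q)
    (h' : T.rightChild p' = some q) : False := by
  obtain ⟨h0, h1, h2, h4, h3⟩ := leftChild_spec h
  obtain ⟨h0', h1', h2', h4', h3'⟩ := rightChild_spec h'
  have : p = p' := eq_of_block_mem h1 h1' (by omega) (by omega) (by omega) (by omega) (by omega)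
  subst this
  omega

theorem kids_inj {p p' q : Fin n} (h : q ∈ T.kids p) (h' : q ∈ T.kids p') : p = p' := by
  rw [mem_kids] at h h'
  rcases h with h | h | h <;> rcases h' with h' | h' | h'
  · exact firstChild_inj h h'
  · exact (firstChild_ne_leftChild h h').elim
  · exact (firstChild_ne_rightChild h h').elim
  · exact (firstChild_ne_leftChild h' h).elim
  · exact leftChild_inj h h'
  · exact (leftChild_ne_rightChild h h').elim
  · exact (firstChild_ne_rightChild h' h).elim
  · exact (leftChild_ne_rightChild h' h).elim
  · exact rightChild_inj h h'

end StoredTree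
end SpatialTree

namespace SpatialTree
namespace StoredTree

variable {n : ℕ} {T : StoredTree n}

/-! ### Sizes of subtrees -/

theorem parent_le (h : ∀ v ≠ T.root, T.parent v < v) (v : Fin n) : T.parent v ≤ v := by
  by_cases hv : v = T.root
  · rw [hv, T.parent_root]
  · exact (h v hv).le

theorem iterate_parent_le (h : ∀ v ≠ T.root, T.parent v < v) (k : ℕ) (v : Fin n) :
    T.parent^[k] v ≤ v := by
  induction k with
  | zero => exact le_rfl
  | succ k ih =>
    rw [Function.iterate_succ_apply']
    exact (parent_le h _).trans ih

/-- Climbing on from a child of `v` leads to `v` and then never to a larger position, so no child of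
`v` is met again. This makes the subtrees of siblings disjoint. -/
theorem iterate_parent_child_ne (h : ∀ v ≠ T.root, T.parent v < v) {v c c' u : Fin n}
    (hc : c ∈ T.children v) (hc' : c' ∈ T.children v) {k l : ℕ} (hkl : k < l)
    (h1 : T.parent^[k] u = c) : T.parent^[l] u ≠ c' := by
  intro h2
  obtain ⟨j, rfl⟩ : ∃ j, l = j + 1 + k := ⟨l - k - 1, by omega⟩
  rw [Function.iterate_add_apply, h1, Function.iterate_succ_apply, (T.mem_children.1 hc).2] at h2
  have h3 := iterate_parent_le h j v
  have h4 := h c' (T.mem_children.1 hc').1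
  rw [h2] at h3
  rw [(T.mem_children.1 hc').2] at h4
  exact absurd h4 (not_lt.2 h3)

theorem subtreeSize_eq (h : ∀ v ≠ T.root, T.parent v < v) (v : Fin n) :
    T.subtreeSize v = 1 + ∑ c ∈ T.children v, T.subtreeSize c := by
  classical
  have hset : (Finset.univ.filter fun u : Fin n => ∃ k : ℕ, T.parent^[k] u = v) =
      insert v ((T.children v).biUnion fun c =>
        Finset.univ.filter fun u : Fin n => ∃ k : ℕ, T.parent^[k] u = c) := by
    ext u
    simp only [Finset.mem_filter, Finset.mem_univ, true_and, Finset.mem_insert,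
      Finset.mem_biUnion]
    constructor
    · rintro ⟨k, hk⟩
      induction k with
      | zero => exact Or.inl hk
      | succ k ih =>
        rw [Function.iterate_succ_apply'] at hk
        by_cases hr : T.parent^[k] u = T.root
        · rw [hr, T.parent_root] at hk
          exact ih (hr.trans hk)
        · exact Or.inr ⟨_, T.mem_children.2 ⟨hr, hk⟩, k, rfl⟩
    · rintro (rfl | ⟨c, hc, k, hk⟩)
      · exact ⟨0, rfl⟩
      · exact ⟨k + 1, by rw [Function.iterate_succ_apply', hk, (T.mem_children.1 hc).2]⟩
  have hcard : T.subtreeSize v =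
      (Finset.univ.filter fun u : Fin n => ∃ k : ℕ, T.parent^[k] u = v).card := by
    unfold subtreeSize
    congr
  rw [hcard, hset, Finset.card_insert_of_notMem, Finset.card_biUnion, add_comm]
  · congr 1
  · intro c hc c' hc' hne
    refine Finset.disjoint_left.2 fun u hu hu' => ?_
    simp only [Finset.mem_filter, Finset.mem_univ, true_and] at hu hu'
    obtain ⟨k, hk⟩ := hu
    obtain ⟨l, hl⟩ := hu'
    rcases lt_trichotomy k l with hlt | rfl | hlt
    · exact iterate_parent_child_ne h hc hc' hlt hk hl
    · exact hne (hk.symm.trans hl)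
    · exact iterate_parent_child_ne h hc' hc hlt hl hk
  · simp only [Finset.mem_biUnion, Finset.mem_filter, Finset.mem_univ, true_and, not_exists,
      not_and]
    intro c hc k hk
    have h1 := iterate_parent_le h k v
    have h2 := h c (T.mem_children.1 hc).1
    rw [(T.mem_children.1 hc).2] at h2
    rw [hk] at h1
    exact absurd h2 (not_lt.2 h1)

/-- Children lie at larger positions, so the recursion has only one solution. It yields the subtree
sizes of the virtual tree without counting its descendants. -/
theorem eq_subtreeSize (h : ∀ v ≠ T.root, T.parent v < v) {g : Fin n → ℕ}
    (hg : ∀ v, g v = 1 + ∑ c ∈ T.children v, g c) : g = T.subtreeSize := by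
  have key : ∀ (k : ℕ) (v : Fin n), n - v ≤ k → g v = T.subtreeSize v := by
    intro k
    induction k with
    | zero => intro v hv; have := v.2; omega
    | succ k ih =>
      intro v hv
      rw [hg, subtreeSize_eq h]
      congr 1
      refine Finset.sum_congr rfl fun c hc => ih c ?_
      have h1 := h c (T.mem_children.1 hc).1
      rw [(T.mem_children.1 hc).2, Fin.lt_def] at h1
      omega
  exact funext fun v => key _ v le_rfl

theorem sum_children (T : StoredTree n) (v : Fin n) (f : Fin n → ℕ) :
    ∑ c ∈ T.children v, f c = ((T.childList v).map f).sum := by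
  rw [childList, ← List.sum_toFinset _ (Finset.sort_nodup _ _), Finset.sort_toFinset]

theorem LightFirst.childList_getElem (hT : T.LightFirst) {v c : Fin n} {i : ℕ}
    (h : (T.childList v)[i]? = some c) :
    (c : ℕ) = v + 1 + (((T.childList v).take i).map T.subtreeSize).sum := by
  obtain ⟨hi, rfl⟩ := List.getElem?_eq_some_iff.1 h
  exact (hT v).2 i hi

theorem LightFirst.parent_lt (hT : T.LightFirst) (v : Fin n) (hv : v ≠ T.root) :
    T.parent v < v := by
  have hm : v ∈ T.childList (T.parent v) := T.mem_childList.2 ⟨hv, rfl⟩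
  obtain ⟨i, hi⟩ := List.mem_iff_getElem?.1 hm
  have := hT.childList_getElem hi
  rw [Fin.lt_def]
  omega

theorem LightFirst.subtreeSize_eq_sum (hT : T.LightFirst) (v : Fin n) :
    T.subtreeSize v = 1 + ((T.childList v).map T.subtreeSize).sum := by
  rw [subtreeSize_eq hT.parent_lt, sum_children]

/-! ### Sizes along a list of siblings -/

/-- The size of the subtree rooted at the `i`-th sibling of `v`. -/
noncomputable def sz (T : StoredTree n) (v : Fin n) (i : ℕ) : ℕ :=
  ((T.sibs v)[i]?.map T.subtreeSize).getD 0

/-- The number of vertices below the block rooted at `v`. -/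
noncomputable def blockSize (T : StoredTree n) (v : Fin n) : ℕ :=
  ∑ i ∈ Finset.Ico (T.idx v) (T.idx v + T.len v), T.sz v i

theorem sz_congr {u v : Fin n} (h : T.sibs u = T.sibs v) : T.sz u = T.sz v := by
  funext i
  rw [sz, sz, h]

theorem sz_of_getElem? {u v : Fin n} {i : ℕ} (h : (T.sibs v)[i]? = some u) :
    T.sz v i = T.subtreeSize u := by
  simp [sz, h]

theorem sum_range_take {α : Type*} (f : α → ℕ) (l : List α) (i : ℕ) :
    ∑ k ∈ Finset.range i, ((l[k]?).map f).getD 0 = ((l.take i).map f).sum := by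
  induction l generalizing i with
  | nil => simp
  | cons a l ih =>
    cases i with
    | zero => simp
    | succ i => rw [Finset.sum_range_succ']; simp [ih, add_comm]

/-- Subtrees of consecutive siblings are adjacent: subtract the position formulas of the two
siblings. The root is the trivial case of a one-element list. -/
theorem LightFirst.getElem?_eq (hT : T.LightFirst) {u v w : Fin n} {i j : ℕ}
    (hu : (T.sibs v)[i]? = some u) (hw : (T.sibs v)[j]? = some w) (hij : i ≤ j) :
    (w : ℕ) = u + ∑ k ∈ Finset.Ico i j, T.sz v k := by
  by_cases hv : v = T.root
  · rw [sibs, if_pos hv] at hu hw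
    obtain ⟨hi, rfl⟩ := List.getElem?_eq_some_iff.1 hu
    obtain ⟨hj, rfl⟩ := List.getElem?_eq_some_iff.1 hw
    simp only [List.length_singleton, Nat.lt_one_iff] at hi hj
    subst hi hj
    simp
  · have h1 := Finset.sum_range_add_sum_Ico (T.sz v) hij
    have e : ∀ l, ∑ k ∈ Finset.range l, T.sz v k = (((T.sibs v).take l).map T.subtreeSize).sum :=
      fun l => sum_range_take _ _ _
    rw [e, e] at h1
    have hs : T.sibs v = T.childList (T.parent v) := by rw [sibs, if_neg hv]
    rw [hs] at hu hw h1
    rw [hT.childList_getElem hu, hT.childList_getElem hw]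
    omega

theorem LightFirst.sz_le (hT : T.LightFirst) {v : Fin n} {i j : ℕ} (hij : i ≤ j)
    (hj : j < (T.sibs v).length) : T.sz v i ≤ T.sz v j := by
  rcases hij.eq_or_lt with rfl | hlt
  · exact le_rfl
  rw [sz_of_getElem? (List.getElem?_eq_getElem hj),
    sz_of_getElem? (List.getElem?_eq_getElem (hlt.trans hj))]
  have hp : (T.sibs v).Pairwise fun c c' => T.subtreeSize c ≤ T.subtreeSize c' := by
    unfold sibs
    split_ifs
    · simp
    · exact (hT _).1
  exact List.pairwise_iff_getElem.1 hp i j _ hj hlt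

theorem sz_idx (v : Fin n) : T.sz v (T.idx v) = T.subtreeSize v :=
  sz_of_getElem? (T.getElem?_idx v)

theorem blockSize_firstChild {p q : Fin n} (h : T.firstChild p = some q) :
    T.blockSize q = ((T.childList p).map T.subtreeSize).sum := by
  obtain ⟨h1, h2, h3, -, h5⟩ := firstChild_spec h
  rw [blockSize, h3, h5, zero_add, ← Finset.range_eq_Ico]
  unfold sz
  rw [sum_range_take, List.take_length, sibs, if_neg h1, h2]

theorem blockSize_leftChild {p q : Fin n} (h : T.leftChild p = some q) :
    T.blockSize q = ∑ i ∈ Finset.Ico (T.idx p + 1) (T.idx p + 1 + (T.len p - 1) / 2),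
      T.sz p i := by
  obtain ⟨-, h2, h3, h4, -⟩ := leftChild_spec h
  rw [blockSize, h3, h4, sz_congr h2]

theorem blockSize_rightChild {p q : Fin n} (h : T.rightChild p = some q) :
    T.blockSize q = ∑ i ∈ Finset.Ico (T.idx p + 1 + (T.len p - 1) / 2) (T.idx p + T.len p),
      T.sz p i := by
  obtain ⟨h1, h2, h3, h4, -⟩ := rightChild_spec h
  rw [blockSize, h3, h4, sz_congr h2]
  congr 2
  omega

theorem LightFirst.blockSize_firstChild_add_one (hT : T.LightFirst) (p : Fin n) :
    ((T.firstChild p).toList.map T.blockSize).sum + 1 = T.subtreeSize p := by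
  rw [hT.subtreeSize_eq_sum]
  cases h : T.firstChild p with
  | none =>
    have : T.childList p = [] := by
      simpa [firstChild] using h
    simp [this]
  | some q => simp [blockSize_firstChild h, add_comm]

theorem leftChild_eq_none {p : Fin n} (h : ¬ 3 ≤ T.len p) : T.leftChild p = none := by
  rw [leftChild, if_neg h]

theorem rightChild_eq_none {p : Fin n} (h : ¬ 2 ≤ T.len p) : T.rightChild p = none := by
  rw [rightChild, if_neg h]

/-- In list form this also covers blocks without a left part, for which the interval is empty. -/
theorem sum_blockSize_leftChild (p : Fin n) : ((T.leftChild p).toList.map T.blockSize).sum =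
    ∑ i ∈ Finset.Ico (T.idx p + 1) (T.idx p + 1 + (T.len p - 1) / 2), T.sz p i := by
  by_cases h : 3 ≤ T.len p
  · obtain ⟨q, hq⟩ := T.exists_leftChild h
    simp [hq, blockSize_leftChild hq]
  · rw [leftChild_eq_none h, Finset.Ico_eq_empty (by omega)]
    simp

theorem sum_blockSize_rightChild (p : Fin n) : ((T.rightChild p).toList.map T.blockSize).sum =
    ∑ i ∈ Finset.Ico (T.idx p + 1 + (T.len p - 1) / 2) (T.idx p + T.len p), T.sz p i := by
  by_cases h : 2 ≤ T.len p
  · obtain ⟨q, hq⟩ := T.exists_rightChild h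
    simp [hq, blockSize_rightChild hq]
  · rw [rightChild_eq_none h, Finset.Ico_eq_empty (by omega)]
    simp

/-- The block consists of `v`, the left part and the right part; `v` itself contributes `s(v)`, one
more than the size below its first child. -/
theorem LightFirst.blockSize_eq (hT : T.LightFirst) (v : Fin n) :
    T.blockSize v = 1 + ((T.kids v).map T.blockSize).sum := by
  have h1 := (T.block_len v).one_le
  rw [kids, List.map_append, List.map_append, List.sum_append, List.sum_append,
    sum_blockSize_leftChild, sum_blockSize_rightChild,
    Finset.sum_Ico_consecutive _ (by omega) (by omega), ← add_assoc,
    add_comm 1, hT.blockSize_firstChild_add_one, ← sz_idx, blockSize,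
    Finset.sum_eq_sum_Ico_succ_bot (by omega)]

/-! ### The virtual tree is stored in light-first order -/

/-- The intervals of lengths `g c`, for `c` in a list, follow one another from position `a`. -/
def Consec (g : Fin n → ℕ) : ℕ → List (Fin n) → Prop
  | _, [] => True
  | a, c :: l => (c : ℕ) = a ∧ Consec g (a + g c) l

theorem Consec.getElem {g : Fin n → ℕ} {a : ℕ} {l : List (Fin n)} (h : Consec g a l) (i : ℕ)
    (hi : i < l.length) : (l[i] : ℕ) = a + ((l.take i).map g).sum := by
  induction l generalizing a i with
  | nil => simp at hi
  | cons c l ih =>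
    cases i with
    | zero => simpa using h.1
    | succ i =>
      have := ih h.2 i (by simpa using hi)
      simp [this, add_assoc]

theorem Consec.le_of_mem {g : Fin n → ℕ} {a : ℕ} {l : List (Fin n)} (h : Consec g a l)
    {c : Fin n} (hc : c ∈ l) : a ≤ c := by
  obtain ⟨i, hi, rfl⟩ := List.mem_iff_getElem.1 hc
  rw [h.getElem i hi]
  omega

theorem Consec.pairwise {g : Fin n → ℕ} (hg : ∀ v, 1 ≤ g v) {a : ℕ} {l : List (Fin n)}
    (h : Consec g a l) : l.Pairwise (· < ·) := by
  induction l generalizing a with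
  | nil => simp
  | cons c l ih =>
    rw [List.pairwise_cons]
    refine ⟨fun b hb => ?_, ih h.2⟩
    have h1 := h.2.le_of_mem hb
    have h2 := h.1
    have h3 := hg c
    rw [Fin.lt_def]
    omega

/-- The proper descendants of `v` in `T` fill the positions up to `v + s(v)`; there the next sibling
begins, and with it the left part, followed by the right part. -/
theorem LightFirst.consec_kids (hT : T.LightFirst) (v : Fin n) :
    Consec T.blockSize (v + 1) (T.kids v) := by
  have hlr : Consec T.blockSize (v + T.subtreeSize v)
      ((T.leftChild v).toList ++ (T.rightChild v).toList) := by
    have hr : ∀ q, T.rightChild v = some q → (q : ℕ) =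
        v + T.subtreeSize v + ((T.leftChild v).toList.map T.blockSize).sum := by
      intro q hq
      have hq' : (T.sibs v)[T.idx v + 1 + (T.len v - 1) / 2]? = some q := by
        have := (rightChild_spec hq).1
        rwa [rightChild, if_pos this] at hq
      rw [sum_blockSize_leftChild, hT.getElem?_eq (T.getElem?_idx v) hq' (by omega),
        Finset.sum_eq_sum_Ico_succ_bot (by omega), sz_idx]
      ring
    have hl : ∀ q, T.leftChild v = some q → (q : ℕ) = v + T.subtreeSize v := by
      intro q hq
      have hq' : (T.sibs v)[T.idx v + 1]? = some q := by
        have := (leftChild_spec hq).1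
        rwa [leftChild, if_pos this] at hq
      rw [hT.getElem?_eq (T.getElem?_idx v) hq' (by omega)]
      simp [sz_idx]
    cases h1 : T.leftChild v <;> cases h2 : T.rightChild v <;> simp_all [Consec]
  have hf := hT.blockSize_firstChild_add_one v
  rw [kids]
  cases h : T.firstChild v with
  | none =>
    rw [h] at hf
    simp only [Option.toList_none, List.map_nil, List.sum_nil, zero_add] at hf
    rwa [← hf] at hlr
  | some q =>
    rw [h] at hf
    simp only [Option.toList_some, List.map_cons, List.map_nil, List.sum_cons, List.sum_nil,
      add_zero] at hf
    refine ⟨?_, ?_⟩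
    · simpa using hT.childList_getElem h
    · rwa [← hf, add_comm (T.blockSize q), ← add_assoc] at hlr

theorem one_le_blockSize (hT : T.LightFirst) (v : Fin n) : 1 ≤ T.blockSize v := by
  rw [hT.blockSize_eq]
  omega

theorem LightFirst.pairwise_kids (hT : T.LightFirst) (v : Fin n) :
    (T.kids v).Pairwise fun c c' => T.blockSize c ≤ T.blockSize c' := by
  -- A nonempty range of later siblings weighs at least `s(v)`, because its first member already
  -- does.
  have key : ∀ a b, T.idx v + 1 ≤ a → a < b → b ≤ T.idx v + T.len v →
      T.subtreeSize v ≤ ∑ i ∈ Finset.Ico a b, T.sz v i := by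
    intro a b ha hab hb
    have hadd := (T.block_len v).add_le
    refine le_trans ?_ (Finset.single_le_sum (f := T.sz v) (fun _ _ => Nat.zero_le _)
      (Finset.mem_Ico.2 ⟨le_refl a, hab⟩))
    rw [← sz_idx]
    exact hT.sz_le (by omega) (by omega)
  have hf : ∀ q, T.firstChild v = some q → T.blockSize q ≤ T.subtreeSize v := by
    intro q hq
    have := hT.blockSize_firstChild_add_one v
    simp only [hq, Option.toList_some, List.map_cons, List.map_nil, List.sum_cons, List.sum_nil,
      add_zero] at this
    omega
  have hl : ∀ q, T.leftChild v = some q → T.subtreeSize v ≤ T.blockSize q := by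
    intro q hq
    have := (leftChild_spec hq).1
    rw [blockSize_leftChild hq]
    exact key _ _ le_rfl (by omega) (by omega)
  have hr : ∀ q, T.rightChild v = some q → T.subtreeSize v ≤ T.blockSize q := by
    intro q hq
    have := (rightChild_spec hq).1
    rw [blockSize_rightChild hq]
    exact key _ _ (by omega) (by omega) le_rfl
  have hlr : ∀ q q', T.leftChild v = some q → T.rightChild v = some q' →
      T.blockSize q ≤ T.blockSize q' := by
    intro q q' hq hq'
    have h3 := (leftChild_spec hq).1
    have hadd := (T.block_len v).add_le
    -- Compare the `k`-th siblings of the two parts; the right part has at least as many terms.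
    rw [blockSize_leftChild hq, blockSize_rightChild hq', Finset.sum_Ico_eq_sum_range,
      Finset.sum_Ico_eq_sum_range]
    refine le_trans (Finset.sum_le_sum fun k hk => ?_)
      (Finset.sum_le_sum_of_subset (Finset.range_mono (by omega)))
    rw [Finset.mem_range] at hk
    exact hT.sz_le (by omega) (by omega)
  have hfl : ∀ q q', T.firstChild v = some q → T.leftChild v = some q' →
      T.blockSize q ≤ T.blockSize q' := fun q q' h h' => (hf q h).trans (hl q' h')
  have hfr : ∀ q q', T.firstChild v = some q → T.rightChild v = some q' →
      T.blockSize q ≤ T.blockSize q' := fun q q' h h' => (hf q h).trans (hr q' h')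
  clear key hf hl hr
  unfold kids
  cases h0 : T.firstChild v <;> cases h1 : T.leftChild v <;> cases h2 : T.rightChild v <;>
    simp_all

theorem LightFirst.lt_of_mem_kids (hT : T.LightFirst) {p q : Fin n} (h : q ∈ T.kids p) :
    p < q := by
  have := (hT.consec_kids p).le_of_mem h
  rw [Fin.lt_def]
  omega

open Classical in
/-- The virtual tree, in which every vertex has at most three children. -/
noncomputable def virtualTree (T : StoredTree n) (hT : T.LightFirst) : StoredTree n where
  root := T.root
  parent v := if h : v ≠ T.root then (T.exists_mem_kids h).choose else T.root
  parent_root := by simp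
  reaches_root := by
    have key : ∀ (k : ℕ) (v : Fin n), (v : ℕ) ≤ k → ∃ j : ℕ, (fun v : Fin n =>
        if h : v ≠ T.root then (T.exists_mem_kids h).choose else T.root)^[j] v = T.root := by
      intro k
      induction k with
      | zero =>
        intro v hv
        by_contra hc
        have h : v ≠ T.root := fun e => hc ⟨0, e⟩
        have := hT.lt_of_mem_kids (T.exists_mem_kids h).choose_spec
        rw [Fin.lt_def] at this
        omega
      | succ k ih =>
        intro v hv
        by_cases h : v ≠ T.root
        · have h1 := hT.lt_of_mem_kids (T.exists_mem_kids h).choose_spec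
          rw [Fin.lt_def] at h1
          obtain ⟨j, hj⟩ := ih (T.exists_mem_kids h).choose (by omega)
          refine ⟨j + 1, ?_⟩
          rw [Function.iterate_succ_apply]
          simpa only [dif_pos h] using hj
        · exact ⟨0, not_not.1 h⟩
    exact fun v => key v v le_rfl

theorem mem_virtualTree_children (hT : T.LightFirst) {p q : Fin n} :
    q ∈ (T.virtualTree hT).children p ↔ q ∈ T.kids p := by
  rw [mem_children]
  constructor
  · rintro ⟨h : q ≠ T.root, rfl⟩
    simp only [virtualTree, dif_pos h]
    exact (T.exists_mem_kids h).choose_spec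
  · intro h
    have hq := T.ne_root_of_mem_kids h
    refine ⟨hq, ?_⟩
    simp only [virtualTree, dif_pos hq]
    exact kids_inj (T.exists_mem_kids hq).choose_spec h

theorem virtualTree_childList (hT : T.LightFirst) (v : Fin n) :
    (T.virtualTree hT).childList v = T.kids v := by
  have hp := (hT.consec_kids v).pairwise (one_le_blockSize hT)
  have hnd : (T.kids v).Nodup := hp.imp ne_of_lt
  have hs : (T.virtualTree hT).children v = (T.kids v).toFinset := by
    ext q
    rw [mem_virtualTree_children, List.mem_toFinset]
  rw [childList, hs]
  exact (List.toFinset_sort (· ≤ ·) hnd).2 (hp.imp le_of_lt)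

theorem virtualTree_subtreeSize (hT : T.LightFirst) :
    (T.virtualTree hT).subtreeSize = T.blockSize := by
  refine (eq_subtreeSize (fun v hv => ?_) fun v => ?_).symm
  · exact hT.lt_of_mem_kids ((mem_virtualTree_children hT).1 (mem_children _ |>.2 ⟨hv, rfl⟩))
  · rw [sum_children, virtualTree_childList, hT.blockSize_eq]

theorem virtualTree_lightFirst (hT : T.LightFirst) : (T.virtualTree hT).LightFirst := by
  intro v
  unfold NeighborhoodLightFirst
  rw [virtualTree_childList, virtualTree_subtreeSize]
  exact ⟨hT.pairwise_kids v, fun i hi => (hT.consec_kids v).getElem i hi⟩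

theorem card_virtualTree_children_le (hT : T.LightFirst) (v : Fin n) :
    ((T.virtualTree hT).children v).card ≤ 3 := by
  have h : ((T.virtualTree hT).childList v).length = ((T.virtualTree hT).children v).card :=
    Finset.length_sort _
  rw [← h, virtualTree_childList, kids]
  cases T.firstChild v <;> cases T.leftChild v <;> cases T.rightChild v <;> simp

end StoredTree

/-- Sending one message along every edge of the virtual tree takes linear energy. -/
theorem Curve.EnergyBound.exists_virtual_bound {K : Curve} (hK : K.EnergyBound) :
    ∃ C : ℕ, ∀ (n : ℕ) (T : StoredTree n), T.LightFirst →
      ∑ p : Fin n, ∑ q : Fin n, (if q ∈ T.kids p then K.dist p q else 0) ≤ C * n := by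
  obtain ⟨C, hC⟩ := hK 3
  refine ⟨C, fun n T hT => le_trans (le_of_eq ?_) (hC n (T.virtualTree hT)
    (StoredTree.virtualTree_lightFirst hT) (StoredTree.card_virtualTree_children_le hT))⟩
  refine Finset.sum_congr rfl fun p _ => ?_
  rw [← Finset.sum_filter]
  refine Finset.sum_congr ?_ fun _ _ => rfl
  ext q
  simp [StoredTree.mem_virtualTree_children hT]

theorem Curve.dist_comm (K : Curve) {n : ℕ} (i j : Fin n) : K.dist i j = K.dist j i := by
  unfold Curve.dist
  omega

end SpatialTree

namespace SpatialTree

/-! ### The program -/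

namespace WordExpr

/-- `if a = b then x else y` -/
def ifEq {r c : ℕ} (a b x y : WordExpr r c) : WordExpr r c := ifLe a b (ifLe b a x y) y

theorem eval_ifEq {r s c : ℕ} {M : Type*} (e : Env r s c M) (a b x y : WordExpr r c) :
    (ifEq a b x y).eval e = if a.eval e = b.eval e then x.eval e else y.eval e := by
  simp only [ifEq, eval]
  split_ifs <;> first | rfl | omega

end WordExpr

namespace LocalMessaging

open WordExpr

/-- Word expressions of the program, which has ten registers and five channels. -/
abbrev Word := WordExpr 10 5

/-- the round -/
abbrev clock : Word := reg 0
/-- `2 ^ k - 1`, where `k` is the register `levels` -/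
abbrev power : Word := reg 1
/-- the number of levels: after initialization `⌊log₂ n⌋ + 1` -/
abbrev levels : Word := reg 2
/-- the first component of the state of `descend` -/
abbrev offset : Word := reg 3
/-- the second component of the state of `descend`, in the end the length of the block -/
abbrev length : Word := reg 4
/-- the third component of the state of `descend`, in the end the depth of the block -/
abbrev level : Word := reg 5
/-- the sibling that follows the part of the block processed so far -/
abbrev next : Word := reg 6
/-- the root of the right part of the block -/
abbrev middle : Word := reg 7
/-- one plus the processor that has just sent a request, or `0` -/
abbrev requester : Word := reg 8
/-- one plus the first child, in the round after it reported, otherwise `0` -/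
abbrev reporter : Word := reg 9

/-- the round in which the block rooted at the own vertex is first worked on -/
def begin : Word := add (add levels (const 1)) (mul (const 4) (sub levels level))
/-- the round in which the blocks are complete -/
def turn : Word := add (mul (const 5) levels) (const 6)
/-- the round in which the own vertex passes on the broadcast -/
def relay : Word := add (add turn (const 2)) level
/-- half of the block without its root, rounded down -/
def leftLength : Word := div (sub length (const 1)) (const 2)

/-- Both local broadcast and local reduce; they differ only in the slot `out`. -/
abbrev program (out : Fin 3) : Program where
  regs := 10
  slots := 3
  channels := 5
  -- Channels: 0 requests, 1 replies, 2 reports of first children, 3 the broadcast to a first or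
  -- left child, 4 the broadcast to a right child. The word `n` names no processor and means
  -- silence.
  target := ![
    ifEq clock begin (ifLe (const 3) length next (input .size))
      (ifEq clock (add begin (const 2)) (ifLe (const 2) length next (input .size))
        (input .size)),
    ifLe (const 1) requester (sub requester (const 1)) (input .size),
    ifEq clock turn (ifEq (input .index) (const 1) (input .parent) (input .size)) (input .size),
    ifLe (const 1) reporter (sub reporter (const 1))
      (ifEq clock relay (ifLe (const 3) length (input .right) (input .size)) (input .size)),
    ifEq clock relay (ifLe (const 2) length middle (input .size)) (input .size)]
  word := ![input .self, next, input .self, const 0, const 0]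
  content := ![
    [],
    [(const 1, .slot 0)],
    [(const 1, .slot 0)],
    [(reporter, .own), (const 1, .slot 1)],
    [(const 1, .slot 1)]]
  nextReg := ![
    -- While `levels` still grows it equals the clock, so neither this stopping time nor any
    -- scheduled round is reached prematurely.
    ifLe (add (mul (const 6) levels) (const 11)) clock clock (add clock (const 1)),
    ifLe (input .size) power power (add (mul (const 2) power) (const 1)),
    ifLe (input .size) power levels (add levels (const 1)),
    ifEq clock (const 0) (sub (input .index) (const 1))
      (ifLe offset (const 0) offset (ifLe offset leftLength (sub offset (const 1))
        (sub (sub offset (const 1)) leftLength))),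
    -- The root has input degree `0`; replacing it by `1` makes the root its own only sibling, as in
    -- `sibs`.
    ifEq clock (const 0) (ifLe (input .degree) (const 0) (const 1) (input .degree))
      (ifLe offset (const 0) length (ifLe offset leftLength leftLength
        (div length (const 2)))),
    ifEq clock (const 0) (const 0) (ifLe offset (const 0) level (add level (const 1))),
    ifEq clock (const 0) (input .right) (ifLe (const 1) (arrived 1) (recv 1) next),
    ifEq clock (add begin (const 2)) next middle,
    ifLe (const 1) (arrived 0) (add (recv 0) (const 1)) (const 0),
    ifLe (const 1) (arrived 2) (add (recv 2) (const 1)) (const 0)]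
  nextSlot := ![
    [(ifEq clock (const 0) (const 1) (const 0), .own), (const 1, .slot 0), (const 1, .recv 1)],
    [(const 1, .slot 1), (const 1, .recv 3), (const 1, .recv 4)],
    [(const 1, .slot 2), (const 1, .recv 2)]]
  out := out

/-! ### One round and one packet, expressed through registers and slots -/

section Steps

variable {n : ℕ} {out : Fin 3} {T : StoredTree n} {M : Type*} {op : M → M → M} {m : Fin n → M}

/-- The value of a register. -/
abbrev rg (μ : Mem (program out) M) (i : Fin 10) : ℕ := μ.reg i

/-- The content of a slot. -/
abbrev sl (μ : Mem (program out) M) (i : Fin 3) : Option M := μ.slot i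

/-- The packet that has arrived on a channel. -/
abbrev inb (T : StoredTree n) (op : M → M → M) (m : Fin n → M) (σ : Fin n → Mem (program out) M)
    (q : Fin n) (ch : Fin 5) : Option (Packet M) := inbox (program out) T op m σ q ch

variable (σ : Fin n → Mem (program out) M) (q : Fin n)

/-- The round in which the block rooted at the own vertex is first worked on, as computed from
the memory. -/
def beginOf (μ : Mem (program out) M) : ℕ := rg μ 2 + 1 + 4 * (rg μ 2 - rg μ 5)

theorem round_clock : rg (round (program out) T op m σ q) 0 =
    if 6 * rg (σ q) 2 + 11 ≤ rg (σ q) 0 then rg (σ q) 0 else rg (σ q) 0 + 1 := rfl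

theorem round_power : rg (round (program out) T op m σ q) 1 =
    if n ≤ rg (σ q) 1 then rg (σ q) 1 else 2 * rg (σ q) 1 + 1 := rfl

theorem round_levels : rg (round (program out) T op m σ q) 2 =
    if n ≤ rg (σ q) 1 then rg (σ q) 2 else rg (σ q) 2 + 1 := rfl

theorem round_descend_zero (h : rg (σ q) 0 = 0) :
    rg (round (program out) T op m σ q) 3 = T.input q .index - 1 ∧
    rg (round (program out) T op m σ q) 4 =
      (if T.input q .degree ≤ 0 then 1 else T.input q .degree) ∧
    rg (round (program out) T op m σ q) 5 = 0 := by
  refine ⟨(eval_ifEq _ _ _ _ _).trans (if_pos h), (eval_ifEq _ _ _ _ _).trans (if_pos h),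
    (eval_ifEq _ _ _ _ _).trans (if_pos h)⟩

theorem round_descend (h : rg (σ q) 0 ≠ 0) :
    (rg (round (program out) T op m σ q) 3, rg (round (program out) T op m σ q) 4,
      rg (round (program out) T op m σ q) 5) =
    descend (rg (σ q) 3, rg (σ q) 4, rg (σ q) 5) := by
  have e3 : rg (round (program out) T op m σ q) 3 = if rg (σ q) 3 ≤ 0 then rg (σ q) 3 else
      if rg (σ q) 3 ≤ (rg (σ q) 4 - 1) / 2 then rg (σ q) 3 - 1 else
        rg (σ q) 3 - 1 - (rg (σ q) 4 - 1) / 2 := (eval_ifEq _ _ _ _ _).trans (if_neg h)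
  have e4 : rg (round (program out) T op m σ q) 4 = if rg (σ q) 3 ≤ 0 then rg (σ q) 4 else
      if rg (σ q) 3 ≤ (rg (σ q) 4 - 1) / 2 then (rg (σ q) 4 - 1) / 2 else
        rg (σ q) 4 / 2 := (eval_ifEq _ _ _ _ _).trans (if_neg h)
  have e5 : rg (round (program out) T op m σ q) 5 = if rg (σ q) 3 ≤ 0 then rg (σ q) 5 else
      rg (σ q) 5 + 1 := (eval_ifEq _ _ _ _ _).trans (if_neg h)
  rw [e3, e4, e5]
  simp only [descend, nonpos_iff_eq_zero]
  by_cases h0 : rg (σ q) 3 = 0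
  · simp [h0]
  -- For a positive offset this test agrees with the strict comparison of `offset - 1` in `descend`.
  · by_cases h1 : rg (σ q) 3 ≤ (rg (σ q) 4 - 1) / 2
    · rw [if_neg h0, if_neg h0, if_neg h0, if_neg h0, if_pos h1, if_pos h1, if_pos (by omega)]
    · rw [if_neg h0, if_neg h0, if_neg h0, if_neg h0, if_neg h1, if_neg h1, if_neg (by omega)]

theorem round_next_zero (h : rg (σ q) 0 = 0) :
    rg (round (program out) T op m σ q) 6 = T.input q .right :=
  (eval_ifEq _ _ _ _ _).trans (if_pos h)

theorem round_next_none (h : rg (σ q) 0 ≠ 0) (hi : inb T op m σ q 1 = none) :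
    rg (round (program out) T op m σ q) 6 = rg (σ q) 6 := by
  refine (eval_ifEq _ _ _ _ _).trans ((if_neg h).trans ?_)
  have : inbox (program out) T op m σ q 1 = none := hi
  simp [WordExpr.eval, this]

theorem round_next_some (h : rg (σ q) 0 ≠ 0) {x : Packet M} (hi : inb T op m σ q 1 = some x) :
    rg (round (program out) T op m σ q) 6 = x.word := by
  refine (eval_ifEq _ _ _ _ _).trans ((if_neg h).trans ?_)
  have : inbox (program out) T op m σ q 1 = some x := hi
  simp [WordExpr.eval, this]

theorem round_middle : rg (round (program out) T op m σ q) 7 =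
    if rg (σ q) 0 = beginOf (σ q) + 2 then rg (σ q) 6 else rg (σ q) 7 :=
  eval_ifEq _ _ _ _ _

theorem round_requester : rg (round (program out) T op m σ q) 8 =
    ((inb T op m σ q 0).map fun x => x.word + 1).getD 0 := by
  have h : rg (round (program out) T op m σ q) 8 =
    if 1 ≤ (if (inb T op m σ q 0).isSome then 1 else 0) then
      ((inb T op m σ q 0).map Packet.word).getD 0 + 1 else 0 := rfl
  rw [h]
  cases inb T op m σ q 0 <;> simp

theorem round_reporter : rg (round (program out) T op m σ q) 9 =
    ((inb T op m σ q 2).map fun x => x.word + 1).getD 0 := by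
  have h : rg (round (program out) T op m σ q) 9 =
    if 1 ≤ (if (inb T op m σ q 2).isSome then 1 else 0) then
      ((inb T op m σ q 2).map Packet.word).getD 0 + 1 else 0 := rfl
  rw [h]
  cases inb T op m σ q 2 <;> simp

theorem round_acc_eq : sl (round (program out) T op m σ q) 0 =
    Option.merge op (Option.merge op (if rg (σ q) 0 = 0 then some (m q) else none) (sl (σ q) 0))
      ((inb T op m σ q 1).bind Packet.content) := by
  have h : sl (round (program out) T op m σ q) 0 = combineList op
      [if (if rg (σ q) 0 ≤ 0 then (if 0 ≤ rg (σ q) 0 then 1 else 0) else 0) = 0 then none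
        else some (m q),
        if (1 : ℕ) = 0 then none else sl (σ q) 0,
        if (1 : ℕ) = 0 then none else (inb T op m σ q 1).bind Packet.content] := rfl
  rw [h]
  by_cases h0 : rg (σ q) 0 = 0 <;> simp [combineList, h0]

theorem round_acc_zero (h : rg (σ q) 0 = 0) : sl (round (program out) T op m σ q) 0 =
    Option.merge op (Option.merge op (some (m q)) (sl (σ q) 0))
      ((inb T op m σ q 1).bind Packet.content) := by
  rw [round_acc_eq, if_pos h]

theorem round_acc (h : rg (σ q) 0 ≠ 0) : sl (round (program out) T op m σ q) 0 =
    Option.merge op (sl (σ q) 0) ((inb T op m σ q 1).bind Packet.content) := by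
  rw [round_acc_eq, if_neg h, Option.merge_none_left]

theorem round_broadcast : sl (round (program out) T op m σ q) 1 =
    Option.merge op (Option.merge op (sl (σ q) 1) ((inb T op m σ q 3).bind Packet.content))
      ((inb T op m σ q 4).bind Packet.content) := by
  have h : sl (round (program out) T op m σ q) 1 = combineList op
      [if (1 : ℕ) = 0 then none else sl (σ q) 1,
        if (1 : ℕ) = 0 then none else (inb T op m σ q 3).bind Packet.content,
        if (1 : ℕ) = 0 then none else (inb T op m σ q 4).bind Packet.content] := rfl
  rw [h]
  simp [combineList]

theorem round_reduce : sl (round (program out) T op m σ q) 2 =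
    Option.merge op (sl (σ q) 2) ((inb T op m σ q 2).bind Packet.content) := by
  have h : sl (round (program out) T op m σ q) 2 = combineList op
      [if (1 : ℕ) = 0 then none else sl (σ q) 2,
        if (1 : ℕ) = 0 then none else (inb T op m σ q 2).bind Packet.content] := rfl
  rw [h]
  simp [combineList]

/-- The target words of the five channels. -/
abbrev tg (T : StoredTree n) (m : Fin n → M) (σ : Fin n → Mem (program out) M) (p : Fin n)
    (ch : Fin 5) : ℕ :=
  ((program out).target ch).eval (sendEnv (program out) T m σ p)

theorem target_zero : tg T m σ q 0 =
    if rg (σ q) 0 = beginOf (σ q) then (if 3 ≤ rg (σ q) 4 then rg (σ q) 6 else n)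
    else if rg (σ q) 0 = beginOf (σ q) + 2 then (if 2 ≤ rg (σ q) 4 then rg (σ q) 6 else n)
    else n := by
  refine (eval_ifEq _ _ _ _ _).trans (if_congr Iff.rfl rfl (eval_ifEq _ _ _ _ _))

theorem target_one : tg T m σ q 1 = if 1 ≤ rg (σ q) 8 then rg (σ q) 8 - 1 else n := rfl

theorem target_two : tg T m σ q 2 =
    if rg (σ q) 0 = 5 * rg (σ q) 2 + 6 then
      (if T.input q .index = 1 then T.input q .parent else n) else n := by
  refine (eval_ifEq _ _ _ _ _).trans (if_congr Iff.rfl (eval_ifEq _ _ _ _ _) rfl)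

theorem target_three : tg T m σ q 3 =
    if 1 ≤ rg (σ q) 9 then rg (σ q) 9 - 1 else
      if rg (σ q) 0 = 5 * rg (σ q) 2 + 6 + 2 + rg (σ q) 5 then
        (if 3 ≤ rg (σ q) 4 then T.input q .right else n) else n := by
  exact if_congr Iff.rfl rfl (eval_ifEq _ _ _ _ _)

theorem target_four : tg T m σ q 4 =
    if rg (σ q) 0 = 5 * rg (σ q) 2 + 6 + 2 + rg (σ q) 5 then
      (if 2 ≤ rg (σ q) 4 then rg (σ q) 7 else n) else n := eval_ifEq _ _ _ _ _

/-- The packets sent on the five channels. -/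
abbrev pk (T : StoredTree n) (op : M → M → M) (m : Fin n → M)
    (σ : Fin n → Mem (program out) M) (p : Fin n) (ch : Fin 5) : Packet M :=
  packet (program out) T op m σ p ch

theorem packet_zero_word : (pk T op m σ q 0).word = q := rfl

theorem packet_one : pk T op m σ q 1 = ⟨rg (σ q) 6, sl (σ q) 0⟩ := by
  have h : pk T op m σ q 1 = ⟨rg (σ q) 6, combineList op
    [if (1 : ℕ) = 0 then none else sl (σ q) 0]⟩ := rfl
  rw [h]
  simp [combineList]

theorem packet_two : pk T op m σ q 2 = ⟨q, sl (σ q) 0⟩ := by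
  have h : pk T op m σ q 2 = ⟨q, combineList op
    [if (1 : ℕ) = 0 then none else sl (σ q) 0]⟩ := rfl
  rw [h]
  simp [combineList]

theorem packet_three : pk T op m σ q 3 =
    ⟨0, Option.merge op (if rg (σ q) 9 = 0 then none else some (m q)) (sl (σ q) 1)⟩ := by
  have h : pk T op m σ q 3 = ⟨0, combineList op
    [if rg (σ q) 9 = 0 then none else some (m q),
      if (1 : ℕ) = 0 then none else sl (σ q) 1]⟩ := rfl
  rw [h]
  simp [combineList]

theorem packet_four : pk T op m σ q 4 = ⟨0, sl (σ q) 1⟩ := by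
  have h : pk T op m σ q 4 = ⟨0, combineList op
    [if (1 : ℕ) = 0 then none else sl (σ q) 1]⟩ := rfl
  rw [h]
  simp [combineList]

end Steps

end LocalMessaging
end SpatialTree

namespace SpatialTree
namespace StoredTree

variable {n : ℕ} (T : StoredTree n)

/-! ### The input words in terms of sibling lists -/

/-- The reference to the sibling of `v` at position `j`. -/
def ref (v : Fin n) (j : ℕ) : ℕ := refWord (T.sibs v)[j]?

theorem refWord_le (x : Option (Fin n)) : refWord x ≤ n := by
  cases x with
  | none => exact le_rfl
  | some p => exact p.2.le

theorem sibs_of_ne_root {v : Fin n} (h : v ≠ T.root) : T.sibs v = T.childList (T.parent v) := by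
  rw [sibs, if_neg h]

theorem idx_of_ne_root {v : Fin n} (h : v ≠ T.root) : T.idx v = T.childIndex v := by
  rw [idx, T.sibs_of_ne_root h, childIndex]

theorem sibs_root : T.sibs T.root = [T.root] := by
  rw [sibs, if_pos rfl]

theorem idx_root : T.idx T.root = 0 := by
  rw [idx, sibs_root]
  simp

theorem input_index_sub_one (v : Fin n) : T.input v .index - 1 = T.idx v := by
  by_cases h : v = T.root
  · subst h
    simp [input, idx_root]
  · simp [input, h, T.idx_of_ne_root h]

theorem input_degree (v : Fin n) :
    (if T.input v .degree ≤ 0 then 1 else T.input v .degree) = (T.sibs v).length := by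
  by_cases h : v = T.root
  · subst h
    simp [input, sibs_root]
  · have h1 := T.idx_lt v
    have h2 : T.input v .degree = (T.sibs v).length := by
      simp [input, h, T.sibs_of_ne_root h]
    rw [h2, if_neg (by omega)]

theorem input_right (v : Fin n) : T.input v .right = T.ref v (T.idx v + 1) := by
  by_cases h : v = T.root
  · subst h
    simp [input, ref, sibs_root, refWord]
  · simp [input, h, ref, T.sibs_of_ne_root h, T.idx_of_ne_root h]

/-- The processor named by a word. -/
def ofWord (n w : ℕ) : Option (Fin n) := if h : w < n then some ⟨w, h⟩ else none

theorem ofWord_self : ofWord n n = none := by simp [ofWord]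

theorem ofWord_fin (p : Fin n) : ofWord n p = some p := by simp [ofWord]

theorem ofWord_refWord (x : Option (Fin n)) : ofWord n (refWord x) = x := by
  cases x with
  | none => exact ofWord_self
  | some p => exact ofWord_fin p

/-- Index `1` marks exactly the first children, the only vertices that report; the root has index
`0`. -/
theorem ofWord_input_parent (p q : Fin n) :
    ofWord n (if T.input p .index = 1 then T.input p .parent else n) = some q ↔
      T.firstChild q = some p := by
  by_cases h : p = T.root
  · subst h
    have : T.input T.root .index ≠ 1 := by simp [input]
    rw [if_neg this, ofWord_self]
    exact ⟨fun e => by simp at e, fun e => absurd rfl (firstChild_spec e).1⟩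
  · have h1 : T.input p .index = T.idx p + 1 := by simp [input, h, T.idx_of_ne_root h]
    have h2 : T.input p .parent = T.parent p := by simp [input, h]
    rw [h1, h2]
    by_cases h0 : T.idx p = 0
    · rw [if_pos (by omega), ofWord_fin]
      constructor
      · intro e
        rw [← Option.some.inj e]
        exact T.firstChild_parent h h0
      · intro e
        rw [(firstChild_spec e).2.1]
    · rw [if_neg (by omega), ofWord_self]
      exact ⟨fun e => by simp at e, fun e => absurd (firstChild_spec e).2.2.1 h0⟩

theorem length_sibs_le (v : Fin n) : (T.sibs v).length ≤ n := by
  simpa using (T.nodup_sibs v).length_le_card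

theorem parent_eq_of_sibs_eq {p q : Fin n} (hq : q ≠ T.root) (h : T.sibs q = T.sibs p) :
    p ≠ T.root ∧ T.parent p = T.parent q := by
  have hp := T.mem_sibs_self p
  rw [← h, T.sibs_of_ne_root hq] at hp
  exact T.mem_childList.1 hp

/-! ### Combined messages of consecutive siblings -/

variable {M : Type*} (op : M → M → M) (m : Fin n → M)

/-- The combination of the messages of `r` siblings of `v`, starting at position `a`. -/
def segment (v : Fin n) (a r : ℕ) : Option M :=
  combineList op ((((T.sibs v).drop a).take r).map fun c => some (m c))

end StoredTree

/-- `Option.merge op` is associative with neutral element `none`, so a left fold may be cut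
anywhere. Associativity of `op` enters here. -/
theorem combineList_append {M : Type*} (op : M → M → M) [Std.Associative op]
    (l l' : List (Option M)) :
    combineList op (l ++ l') = Option.merge op (combineList op l) (combineList op l') := by
  unfold combineList
  rw [List.foldl_append]
  have key : ∀ (l : List (Option M)) (x y : Option M),
      l.foldl (Option.merge op) (Option.merge op x y) =
        Option.merge op x (l.foldl (Option.merge op) y) := by
    intro l
    induction l with
    | nil => intro x y; rfl
    | cons a l ih =>
      intro x y
      rw [List.foldl_cons, List.foldl_cons, Std.Associative.assoc (op := Option.merge op), ih]
  have := key l' (l.foldl (Option.merge op) none) none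
  rwa [Option.merge_none_right] at this

namespace StoredTree

variable {n : ℕ} {T : StoredTree n} {M : Type*} {op : M → M → M} {m : Fin n → M}

theorem segment_add [Std.Associative op] (v : Fin n) (a r r' : ℕ) :
    T.segment op m v a (r + r') =
      Option.merge op (T.segment op m v a r) (T.segment op m v (a + r) r') := by
  unfold segment
  rw [List.take_add, List.map_append, combineList_append, List.drop_drop]

theorem segment_one (v : Fin n) : T.segment op m v (T.idx v) 1 = some (m v) := by
  have h := T.getElem?_idx v
  obtain ⟨h1, h2⟩ := List.getElem?_eq_some_iff.1 h
  rw [segment, List.drop_eq_getElem_cons h1, h2]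
  simp [combineList]

theorem segment_congr {u v : Fin n} (h : T.sibs u = T.sibs v) :
    T.segment op m u = T.segment op m v := by
  funext a r
  rw [segment, segment, h]

theorem segment_firstChild {p q : Fin n} (h : T.firstChild p = some q) :
    T.segment op m q (T.idx q) (T.len q) = T.localReduce op m p := by
  obtain ⟨h1, h2, h3, -, h5⟩ := firstChild_spec h
  rw [segment, h3, h5, List.drop_zero, List.take_length, T.sibs_of_ne_root h1, h2, localReduce]

theorem localReduce_of_firstChild_eq_none {p : Fin n} (h : T.firstChild p = none) :
    T.localReduce op m p = none := by
  have : T.childList p = [] := by simpa [firstChild] using h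
  rw [localReduce, this]
  rfl

end StoredTree

namespace LocalMessaging

open StoredTree

variable {n : ℕ} (T : StoredTree n)

/-! ### The schedule -/

/-- A bound on the number of levels of blocks. -/
def lv (n : ℕ) : ℕ := Nat.log 2 n + 1

/-- The round in which the block rooted at `v` is first worked on. -/
def beg (v : Fin n) : ℕ := lv n + 1 + 4 * (lv n - T.dep v)

/-- The round in which the blocks are complete. -/
def trn (n : ℕ) : ℕ := 5 * lv n + 6

theorem dep_lt_lv (v : Fin n) : T.dep v < lv n := by
  have h := (T.block_len v).two_pow_le.trans (T.length_sibs_le v)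
  exact Nat.lt_succ_of_le (Nat.le_log_of_pow_le one_lt_two h)

theorem lt_two_pow_lv : n < 2 ^ lv n := Nat.lt_pow_succ_log_self one_lt_two n

variable {T} in
-- A level takes four rounds: request and reply for each of the two parts. A part is thus complete
-- when its parent starts, and can reply at once.
theorem beg_child {p q : Fin n} (h : T.dep q = T.dep p + 1) : beg T q + 4 = beg T p := by
  have h1 := dep_lt_lv T q
  unfold beg
  omega

/-- In round `t`, `p` sends a request to its child `q`. -/
def Requests (t : ℕ) (p q : Fin n) : Prop :=
  (t = beg T p ∧ T.leftChild p = some q) ∨ (t = beg T p + 2 ∧ T.rightChild p = some q)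

/-- The packets sent in round `t`. -/
def Comm (t : ℕ) (ch : Fin 5) (p q : Fin n) : Prop :=
  match ch with
  | 0 => Requests T t p q
  | 1 => 1 ≤ t ∧ Requests T (t - 1) q p
  | 2 => t = trn n ∧ T.firstChild q = some p
  | 3 => (t = trn n + 1 ∧ T.firstChild p = some q) ∨
      (t = trn n + 2 + T.dep p ∧ T.leftChild p = some q)
  | 4 => t = trn n + 2 + T.dep p ∧ T.rightChild p = some q

variable {T}

theorem Requests.kids {t : ℕ} {p q : Fin n} (h : Requests T t p q) : q ∈ T.kids p := by
  rw [mem_kids]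
  rcases h with ⟨-, h⟩ | ⟨-, h⟩ <;> tauto

theorem Comm.kids {t : ℕ} {ch : Fin 5} {p q : Fin n} (h : Comm T t ch p q) :
    q ∈ T.kids p ∨ p ∈ T.kids q := by
  rw [mem_kids, mem_kids]
  match ch with
  | 0 => exact Or.inl (T.mem_kids.1 (Requests.kids h))
  | 1 => exact Or.inr (T.mem_kids.1 (Requests.kids h.2))
  | 2 => exact Or.inr (Or.inl h.2)
  | 3 => rcases h with ⟨-, h⟩ | ⟨-, h⟩ <;> tauto
  | 4 => exact Or.inl (Or.inr (Or.inr h.2))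

theorem Requests.right_unique {t : ℕ} {p q q' : Fin n} (h : Requests T t p q)
    (h' : Requests T t p q') : q = q' := by
  rcases h with ⟨h1, h2⟩ | ⟨h1, h2⟩ <;> rcases h' with ⟨h3, h4⟩ | ⟨h3, h4⟩
  · exact Option.some.inj (h2.symm.trans h4)
  · omega
  · omega
  · exact Option.some.inj (h2.symm.trans h4)

theorem Requests.time_unique {t t' : ℕ} {p q : Fin n} (h : Requests T t p q)
    (h' : Requests T t' p q) : t = t' := by
  rcases h with ⟨h1, h2⟩ | ⟨h1, h2⟩ <;> rcases h' with ⟨h3, h4⟩ | ⟨h3, h4⟩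
  · omega
  · exact (leftChild_ne_rightChild h2 h4).elim
  · exact (leftChild_ne_rightChild h4 h2).elim
  · omega

/-- Packets going down come from the unique virtual parent. A vertex makes at most one request per
round, so at most one reply arrives, and only its first child reports. -/
theorem Comm.sender_unique {t : ℕ} {ch : Fin 5} {p p' q : Fin n} (h : Comm T t ch p q)
    (h' : Comm T t ch p' q) : p = p' := by
  match ch with
  | 0 => exact kids_inj (Requests.kids h) (Requests.kids h')
  | 1 => exact h.2.right_unique h'.2
  | 2 => exact Option.some.inj (h.2.symm.trans h'.2)
  | 3 =>
    refine kids_inj (T := T) (q := q) ?_ ?_ <;> rw [mem_kids]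
    · rcases h with ⟨-, h⟩ | ⟨-, h⟩ <;> tauto
    · rcases h' with ⟨-, h⟩ | ⟨-, h⟩ <;> tauto
  | 4 => exact rightChild_inj h.2 h'.2

/-- A virtual edge is of only one kind (first, left or right), and the kind together with the upper
end fixes the round. This gives the linear energy. -/
theorem Comm.time_unique {t t' : ℕ} {ch : Fin 5} {p q : Fin n} (h : Comm T t ch p q)
    (h' : Comm T t' ch p q) : t = t' := by
  match ch with
  | 0 => exact Requests.time_unique h h'
  | 1 =>
    have := h.2.time_unique h'.2
    have h1 := h.1
    have h2 := h'.1
    omega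
  | 2 => rw [h.1, h'.1]
  | 3 =>
    rcases h with ⟨h1, h2⟩ | ⟨h1, h2⟩ <;> rcases h' with ⟨h3, h4⟩ | ⟨h3, h4⟩
    · omega
    · exact (firstChild_ne_leftChild h2 h4).elim
    · exact (firstChild_ne_leftChild h4 h2).elim
    · omega
  | 4 => rw [h.1, h'.1]

theorem Requests.lt {t : ℕ} {p q : Fin n} (h : Requests T t p q) :
    lv n < t ∧ t < 5 * lv n + 4 := by
  rcases h with ⟨h, -⟩ | ⟨h, -⟩ <;> unfold beg at h <;> omega

theorem Comm.lt {t : ℕ} {ch : Fin 5} {p q : Fin n} (h : Comm T t ch p q) :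
    t < 6 * lv n + 9 := by
  have hp := dep_lt_lv T p
  match ch with
  | 0 => have := Requests.lt h; omega
  | 1 => have := Requests.lt h.2; omega
  | 2 => have := h.1; unfold trn at this; omega
  | 3 => rcases h with ⟨h, -⟩ | ⟨h, -⟩ <;> unfold trn at h <;> omega
  | 4 => have := h.1; unfold trn at this; omega

/-! ### The invariant -/

variable {out : Fin 3} {M : Type*} {op : M → M → M} {m : Fin n → M}

/-- The state of the execution after `t` rounds. -/
structure Inv (T : StoredTree n) (op : M → M → M) (m : Fin n → M) (t : ℕ)
    (σ : Fin n → Mem (program out) M) : Prop where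
  clock : ∀ v, rg (σ v) 0 = t
  power : ∀ v, rg (σ v) 1 = 2 ^ min t (lv n) - 1
  levels : ∀ v, rg (σ v) 2 = min t (lv n)
  search : 1 ≤ t → ∀ v, (rg (σ v) 3, rg (σ v) 4, rg (σ v) 5) =
    descend^[t - 1] (T.idx v, (T.sibs v).length, 0)
  next_first : ∀ v, 1 ≤ t → t ≤ beg T v + 1 → rg (σ v) 6 = T.ref v (T.idx v + 1)
  next_second : ∀ v, beg T v + 2 ≤ t → t ≤ beg T v + 3 →
    rg (σ v) 6 = T.ref v (T.idx v + 1 + (T.len v - 1) / 2)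
  next_third : ∀ v, beg T v + 4 ≤ t → rg (σ v) 6 = T.ref v (T.idx v + T.len v)
  next_le : ∀ v, rg (σ v) 6 ≤ n
  middle : ∀ v, beg T v + 3 ≤ t → rg (σ v) 7 = T.ref v (T.idx v + 1 + (T.len v - 1) / 2)
  middle_le : ∀ v, rg (σ v) 7 ≤ n
  requester : ∀ v u : Fin n, rg (σ v) 8 = u + 1 ↔ 1 ≤ t ∧ Requests T (t - 1) u v
  requester_le : ∀ v, rg (σ v) 8 ≤ n
  reporter : ∀ v u : Fin n, rg (σ v) 9 = u + 1 ↔ t = trn n + 1 ∧ T.firstChild v = some u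
  reporter_le : ∀ v, rg (σ v) 9 ≤ n
  acc_zero : t = 0 → ∀ v, sl (σ v) 0 = none
  acc_first : ∀ v, 1 ≤ t → t ≤ beg T v + 1 → sl (σ v) 0 = some (m v)
  -- Only the values of combined messages are conditional on associativity, so that the same
  -- invariant serves the broadcast for arbitrary `op`.
  acc_second : Std.Associative op → ∀ v, beg T v + 2 ≤ t → t ≤ beg T v + 3 →
    sl (σ v) 0 = T.segment op m v (T.idx v) (1 + (T.len v - 1) / 2)
  acc_third : Std.Associative op → ∀ v, beg T v + 4 ≤ t →
    sl (σ v) 0 = T.segment op m v (T.idx v) (T.len v)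
  broadcast_none : ∀ v, t < trn n + 2 + T.dep v → sl (σ v) 1 = none
  broadcast_some : ∀ v, v ≠ T.root → trn n + 2 + T.dep v ≤ t →
    sl (σ v) 1 = some (m (T.parent v))
  reduce_none : ∀ v, t ≤ trn n → sl (σ v) 2 = none
  reduce_some : Std.Associative op → ∀ v, trn n + 1 ≤ t → sl (σ v) 2 = T.localReduce op m v

/-! ### The packets determined by the invariant -/

namespace Inv

variable {t : ℕ} {σ : Fin n → Mem (program out) M}

/-- The first round only loads the input; at least `lv n` search steps follow, more than the depth
of any block. -/
theorem settled (h : Inv T op m t σ) (ht : lv n < t) (v : Fin n) :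
    rg (σ v) 3 = 0 ∧ rg (σ v) 4 = T.len v ∧ rg (σ v) 5 = T.dep v := by
  have h1 := h.search (by omega) v
  rw [(T.block_len v).descend_iterate_of_le (by have := dep_lt_lv T v; omega)] at h1
  simpa using h1

/-- Up to round `lv n` the register `levels` equals the clock, so the computed round lies strictly
in the future; afterwards `levels` and `level` are final. -/
theorem clock_eq_begin_iff (h : Inv T op m t σ) (v : Fin n) (j : ℕ) :
    rg (σ v) 0 = beginOf (σ v) + j ↔ t = beg T v + j := by
  rw [h.clock, beginOf, h.levels, beg]
  rcases le_or_gt t (lv n) with ht | ht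
  · rw [min_eq_left ht]
    omega
  · rw [min_eq_right ht.le, (h.settled ht v).2.2]

theorem clock_eq_turn_iff (h : Inv T op m t σ) (v : Fin n) :
    rg (σ v) 0 = 5 * rg (σ v) 2 + 6 ↔ t = trn n := by
  rw [h.clock, h.levels, trn]
  omega

theorem clock_eq_relay_iff (h : Inv T op m t σ) (v : Fin n) :
    rg (σ v) 0 = 5 * rg (σ v) 2 + 6 + 2 + rg (σ v) 5 ↔ t = trn n + 2 + T.dep v := by
  rw [h.clock, h.levels, trn]
  rcases le_or_gt t (lv n) with ht | ht
  · rw [min_eq_left ht]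
    omega
  · rw [min_eq_right ht.le, (h.settled ht v).2.2]

theorem requester_pos (h : Inv T op m t σ) {v : Fin n} (hv : 1 ≤ rg (σ v) 8) :
    ∃ u : Fin n, rg (σ v) 8 = u + 1 := by
  have := h.requester_le v
  exact ⟨⟨rg (σ v) 8 - 1, by omega⟩, by simp only; omega⟩

theorem reporter_pos (h : Inv T op m t σ) {v : Fin n} (hv : 1 ≤ rg (σ v) 9) :
    ∃ u : Fin n, rg (σ v) 9 = u + 1 := by
  have := h.reporter_le v
  exact ⟨⟨rg (σ v) 9 - 1, by omega⟩, by simp only; omega⟩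

theorem recipient_zero (h : Inv T op m t σ) (p q : Fin n) :
    ofWord n (tg T m σ p 0) = some q ↔ Requests T t p q := by
  have h1 := h.clock_eq_begin_iff p 0
  rw [add_zero, add_zero] at h1
  rw [target_zero, Requests, if_congr h1 rfl rfl,
    if_congr (h.clock_eq_begin_iff p 2) rfl rfl]
  by_cases e1 : t = beg T p
  · have ht : lv n < t := by rw [e1, beg]; omega
    rw [if_pos e1, (h.settled ht p).2.1, h.next_first p (by omega) (by omega), leftChild]
    split_ifs with hl
    · rw [ref, ofWord_refWord]
      constructor
      · exact fun e => Or.inl ⟨e1, e⟩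
      · rintro (⟨-, e⟩ | ⟨e, -⟩)
        · exact e
        · omega
    · rw [ofWord_self]
      constructor
      · intro e; simp at e
      · rintro (⟨-, e⟩ | ⟨e, -⟩)
        · simp at e
        · omega
  · rw [if_neg e1]
    by_cases e2 : t = beg T p + 2
    · have ht : lv n < t := by rw [e2, beg]; omega
      rw [if_pos e2, (h.settled ht p).2.1, h.next_second p (by omega) (by omega), rightChild]
      split_ifs with hl
      · rw [ref, ofWord_refWord]
        constructor
        · exact fun e => Or.inr ⟨e2, e⟩
        · rintro (⟨e, -⟩ | ⟨-, e⟩)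
          · omega
          · exact e
      · rw [ofWord_self]
        constructor
        · intro e; simp at e
        · rintro (⟨e, -⟩ | ⟨-, e⟩)
          · omega
          · simp at e
    · rw [if_neg e2, ofWord_self]
      constructor
      · intro e; simp at e
      · rintro (⟨e, -⟩ | ⟨e, -⟩) <;> omega

theorem recipient_one (h : Inv T op m t σ) (p q : Fin n) :
    ofWord n (tg T m σ p 1) = some q ↔ 1 ≤ t ∧ Requests T (t - 1) q p := by
  rw [target_one, ← h.requester]
  split_ifs with h1
  · obtain ⟨u, hu⟩ := h.requester_pos h1
    rw [hu, Nat.add_sub_cancel, ofWord_fin, Option.some.injEq, Fin.ext_iff]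
    omega
  · rw [ofWord_self]
    constructor
    · intro e; simp at e
    · omega

theorem recipient_two (h : Inv T op m t σ) (p q : Fin n) :
    ofWord n (tg T m σ p 2) = some q ↔ t = trn n ∧ T.firstChild q = some p := by
  rw [target_two, if_congr (h.clock_eq_turn_iff p) rfl rfl, ← T.ofWord_input_parent]
  by_cases ht : t = trn n
  · rw [if_pos ht]
    tauto
  · rw [if_neg ht, ofWord_self]
    constructor
    · intro e; simp at e
    · tauto

theorem recipient_three (h : Inv T op m t σ) (p q : Fin n) :
    ofWord n (tg T m σ p 3) = some q ↔ (t = trn n + 1 ∧ T.firstChild p = some q) ∨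
      (t = trn n + 2 + T.dep p ∧ T.leftChild p = some q) := by
  rw [target_three, if_congr (h.clock_eq_relay_iff p) rfl rfl]
  by_cases h1 : 1 ≤ rg (σ p) 9
  · obtain ⟨u, hu⟩ := h.reporter_pos h1
    obtain ⟨h2, h3⟩ := (h.reporter p u).1 hu
    rw [if_pos h1, hu, Nat.add_sub_cancel, ofWord_fin, h3]
    constructor
    · exact fun e => Or.inl ⟨h2, e⟩
    · rintro (⟨-, e⟩ | ⟨e, -⟩)
      · exact e
      · omega
  · have h2 : ¬ (t = trn n + 1 ∧ T.firstChild p = some q) := by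
      rw [← h.reporter]
      omega
    rw [if_neg h1, or_iff_right h2]
    by_cases e1 : t = trn n + 2 + T.dep p
    · have ht : lv n < t := by rw [e1, trn]; omega
      rw [if_pos e1, (h.settled ht p).2.1, T.input_right, leftChild]
      split_ifs
      · rw [ref, ofWord_refWord]
        tauto
      · rw [ofWord_self]
        simp
    · rw [if_neg e1, ofWord_self]
      constructor
      · intro e; simp at e
      · tauto

theorem recipient_four (h : Inv T op m t σ) (p q : Fin n) :
    ofWord n (tg T m σ p 4) = some q ↔
      t = trn n + 2 + T.dep p ∧ T.rightChild p = some q := by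
  rw [target_four, if_congr (h.clock_eq_relay_iff p) rfl rfl]
  by_cases e1 : t = trn n + 2 + T.dep p
  · have ht : lv n < t := by rw [e1, trn]; omega
    rw [if_pos e1, (h.settled ht p).2.1, h.middle p (by rw [e1, trn, beg]; omega), rightChild]
    split_ifs
    · rw [ref, ofWord_refWord]
      tauto
    · rw [ofWord_self]
      simp
  · rw [if_neg e1, ofWord_self]
    constructor
    · intro e; simp at e
    · tauto

theorem recipient_iff (h : Inv T op m t σ) (p q : Fin n) (ch : Fin 5) :
    recipient (program out) T m σ p ch = some q ↔ Comm T t ch p q := by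
  have h0 : recipient (program out) T m σ p ch = ofWord n (tg T m σ p ch) := rfl
  rw [h0]
  match ch with
  | 0 => exact h.recipient_zero p q
  | 1 => exact h.recipient_one p q
  | 2 => exact h.recipient_two p q
  | 3 => exact h.recipient_three p q
  | 4 => exact h.recipient_four p q

theorem inb_eq_some (h : Inv T op m t σ) {p q : Fin n} {ch : Fin 5} (hc : Comm T t ch p q) :
    inb T op m σ q ch = some (pk T op m σ p ch) := by
  unfold inb inbox
  have hs : ((List.finRange n).find? fun p =>
      recipient (program out) T m σ p ch = some q).isSome := by
    rw [List.find?_isSome]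
    exact ⟨p, List.mem_finRange p, decide_eq_true ((h.recipient_iff p q ch).2 hc)⟩
  obtain ⟨p', hp'⟩ := Option.isSome_iff_exists.1 hs
  have h1 := List.find?_some hp'
  rw [decide_eq_true_eq] at h1
  -- `find?` yields some sender on this channel; uniqueness identifies it with the expected one.
  rw [hp', Option.map_some, ((h.recipient_iff p' q ch).1 h1).sender_unique hc]

theorem inb_eq_none (h : Inv T op m t σ) {q : Fin n} {ch : Fin 5}
    (hc : ∀ p, ¬ Comm T t ch p q) : inb T op m σ q ch = none := by
  unfold inb inbox
  rw [Option.map_eq_none_iff, List.find?_eq_none]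
  intro p _ hp
  exact hc p ((h.recipient_iff p q ch).1 (of_decide_eq_true hp))

end Inv

end LocalMessaging
end SpatialTree

/-! ### Preservation of the invariant -/

namespace SpatialTree
namespace LocalMessaging

open StoredTree

variable {n : ℕ} {T : StoredTree n} {out : Fin 3} {M : Type*} {op : M → M → M} {m : Fin n → M}

theorem inv_zero : Inv T op m 0 (state (program out) T op m 0) where
  clock _ := rfl
  power _ := by simp [state]
  levels _ := by simp [state]
  search h := by omega
  next_first _ h := by omega
  next_second _ h := by omega
  next_third _ h := by omega
  next_le _ := Nat.zero_le _
  middle _ h := by omega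
  middle_le _ := Nat.zero_le _
  requester _ _ := by simp [state]
  requester_le _ := Nat.zero_le _
  reporter _ _ := by simp [state]
  reporter_le _ := Nat.zero_le _
  acc_zero _ _ := rfl
  acc_first _ h := by omega
  acc_second _ _ h := by omega
  acc_third _ _ h := by omega
  broadcast_none _ _ := rfl
  broadcast_some _ _ h := by unfold trn at h; omega
  reduce_none _ _ := rfl
  reduce_some _ _ h := by omega

namespace Inv

variable {t : ℕ} {σ : Fin n → Mem (program out) M}

/-- Registers start at `0`, so the program iterates `x ↦ 2x + 1`. As `2 ^ (lv n - 1) ≤ n < 2 ^ lv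
n`, the value first reaches `n` after `lv n` rounds. -/
theorem le_two_pow_sub_one_iff (hn : 0 < n) (t : ℕ) : n ≤ 2 ^ min t (lv n) - 1 ↔ lv n ≤ t := by
  have h1 : n < 2 ^ lv n := lt_two_pow_lv
  constructor
  · intro h
    by_contra hc
    have h2 : 2 ^ min t (lv n) ≤ 2 ^ Nat.log 2 n :=
      Nat.pow_le_pow_right (by omega) (by unfold lv at *; omega)
    have h3 := Nat.pow_log_le_self 2 hn.ne'
    omega
  · intro h
    rw [min_eq_right h]
    omega

/-- The reply of the left child. -/
theorem inb_left (h : Inv T op m t σ) {p q : Fin n} (hq : T.leftChild p = some q)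
    (ht : t = beg T p + 1) :
    inb T op m σ p 1 = some ⟨T.ref p (T.idx p + 1 + (T.len p - 1) / 2), sl (σ q) 0⟩ := by
  obtain ⟨h1, h2, h3, h4, h5⟩ := leftChild_spec hq
  have hb := beg_child h5
  have hc : Comm T t 1 q p := ⟨by omega, Or.inl ⟨by omega, hq⟩⟩
  rw [h.inb_eq_some hc, packet_one, h.next_third q (by omega), ref, ref, h2, h3, h4]

/-- The reply of the right child. -/
theorem inb_right (h : Inv T op m t σ) {p q : Fin n} (hq : T.rightChild p = some q)
    (ht : t = beg T p + 3) :
    inb T op m σ p 1 = some ⟨T.ref p (T.idx p + T.len p), sl (σ q) 0⟩ := by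
  obtain ⟨h1, h2, h3, h4, h5⟩ := rightChild_spec hq
  have hb := beg_child h5
  have hc : Comm T t 1 q p := ⟨by omega, Or.inr ⟨by omega, hq⟩⟩
  have e : T.idx p + 1 + (T.len p - 1) / 2 + T.len p / 2 = T.idx p + T.len p := by omega
  rw [h.inb_eq_some hc, packet_one, h.next_third q (by omega), ref, ref, h2, h3, h4, e]

theorem inb_one_eq_none (h : Inv T op m t σ) {p : Fin n}
    (h1 : t = beg T p + 1 → ¬ 3 ≤ T.len p) (h2 : t = beg T p + 3 → ¬ 2 ≤ T.len p) :
    inb T op m σ p 1 = none := by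
  refine h.inb_eq_none fun q hq => ?_
  rcases hq with ⟨h0, ⟨ht, hq⟩ | ⟨ht, hq⟩⟩
  · exact h1 (by omega) (leftChild_spec hq).1
  · exact h2 (by omega) (rightChild_spec hq).1

/-- Until something is received, `next` and the accumulator keep their values. -/
theorem round_keep (h : Inv T op m t σ) (ht : 1 ≤ t) {p : Fin n}
    (h1 : t = beg T p + 1 → ¬ 3 ≤ T.len p) (h2 : t = beg T p + 3 → ¬ 2 ≤ T.len p) :
    rg (round (program out) T op m σ p) 6 = rg (σ p) 6 ∧
    sl (round (program out) T op m σ p) 0 = sl (σ p) 0 := by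
  have hc : rg (σ p) 0 ≠ 0 := by rw [h.clock]; omega
  have hi := h.inb_one_eq_none h1 h2
  refine ⟨round_next_none σ p hc hi, ?_⟩
  rw [round_acc σ p hc, hi, Option.bind_none, Option.merge_none_right]

theorem round_first (h : Inv T op m t σ) (p : Fin n) (ht : t ≤ beg T p) :
    rg (round (program out) T op m σ p) 6 = T.ref p (T.idx p + 1) ∧
    sl (round (program out) T op m σ p) 0 = some (m p) := by
  rcases Nat.eq_zero_or_pos t with h0 | h0
  · have hc : rg (σ p) 0 = 0 := by rw [h.clock, h0]
    have hi : inb T op m σ p 1 = none := h.inb_one_eq_none (by omega) (by omega)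
    rw [round_next_zero σ p hc, round_acc_zero σ p hc, T.input_right, h.acc_zero h0, hi]
    simp
  · obtain ⟨h1, h2⟩ := h.round_keep h0 (p := p) (by omega) (by omega)
    rw [h1, h2]
    exact ⟨h.next_first p h0 (by omega), h.acc_first p h0 (by omega)⟩

theorem round_second (h : Inv T op m t σ) (p : Fin n) (h1 : beg T p + 1 ≤ t)
    (h2 : t ≤ beg T p + 2) :
    rg (round (program out) T op m σ p) 6 = T.ref p (T.idx p + 1 + (T.len p - 1) / 2) ∧
    (Std.Associative op → sl (round (program out) T op m σ p) 0 =
      T.segment op m p (T.idx p) (1 + (T.len p - 1) / 2)) := by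
  rcases h1.eq_or_lt with h3 | h3
  · by_cases hl : 3 ≤ T.len p
    · obtain ⟨q, hq⟩ := T.exists_leftChild hl
      obtain ⟨-, e2, e3, e4, e5⟩ := leftChild_spec hq
      have hc : rg (σ p) 0 ≠ 0 := by rw [h.clock]; omega
      have hi := h.inb_left hq h3.symm
      refine ⟨round_next_some σ p hc hi, fun ho => ?_⟩
      rw [round_acc σ p hc, hi, Option.bind_some, h.acc_first p (by omega) (by omega),
        h.acc_third ho q (by have := beg_child e5; omega), segment_congr e2, e3, e4,
        segment_add, segment_one]
    -- With an empty left part there is no reply, but the right part then starts at the next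
    -- sibling, which `next` already holds.
    · have e : (T.len p - 1) / 2 = 0 := by omega
      obtain ⟨e1, e2⟩ := h.round_keep (p := p) (by omega) (fun _ => hl) (by omega)
      rw [e1, e2, e, add_zero, add_zero, segment_one]
      exact ⟨h.next_first p (by omega) (by omega), fun _ => h.acc_first p (by omega) (by omega)⟩
  · obtain ⟨e1, e2⟩ := h.round_keep (p := p) (by omega) (by omega) (by omega)
    rw [e1, e2]
    exact ⟨h.next_second p (by omega) (by omega), fun ho => h.acc_second ho p (by omega) (by omega)⟩

theorem round_third (h : Inv T op m t σ) (p : Fin n) (h1 : beg T p + 3 ≤ t) :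
    rg (round (program out) T op m σ p) 6 = T.ref p (T.idx p + T.len p) ∧
    (Std.Associative op → sl (round (program out) T op m σ p) 0 =
      T.segment op m p (T.idx p) (T.len p)) := by
  rcases h1.eq_or_lt with h3 | h3
  · by_cases hl : 2 ≤ T.len p
    · obtain ⟨q, hq⟩ := T.exists_rightChild hl
      obtain ⟨-, e2, e3, e4, e5⟩ := rightChild_spec hq
      have hc : rg (σ p) 0 ≠ 0 := by rw [h.clock]; omega
      have hi := h.inb_right hq h3.symm
      refine ⟨round_next_some σ p hc hi, fun ho => ?_⟩
      -- The accumulator covers the root and the left part; the reply appends the right part, in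
      -- sibling order.
      have e : T.len p = 1 + (T.len p - 1) / 2 + T.len p / 2 := by omega
      have e' := segment_add (T := T) (op := op) (m := m) p (T.idx p) (1 + (T.len p - 1) / 2)
        (T.len p / 2)
      rw [← e, ← add_assoc] at e'
      rw [round_acc σ p hc, hi, Option.bind_some, h.acc_second ho p (by omega) (by omega),
        h.acc_third ho q (by have := beg_child e5; omega), segment_congr e2, e3, e4, e']
    · have e : T.len p = 1 := by have := (T.block_len p).one_le; omega
      obtain ⟨e1, e2⟩ := h.round_keep (p := p) (by omega) (by omega) (fun _ => hl)
      have e3 := h.next_second p (by omega) (by omega)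
      rw [e1, e2, e3, e]
      refine ⟨rfl, fun ho => ?_⟩
      have e4 := h.acc_second ho p (by omega) (by omega)
      rwa [e] at e4
  · obtain ⟨e1, e2⟩ := h.round_keep (p := p) (by omega) (by omega) (by omega)
    rw [e1, e2]
    exact ⟨h.next_third p (by omega), fun ho => h.acc_third ho p (by omega)⟩

theorem round_word_le (h : Inv T op m t σ) (p : Fin n) :
    rg (round (program out) T op m σ p) 6 ≤ n := by
  rcases le_or_gt t (beg T p) with h1 | h1
  · rw [(h.round_first p h1).1]
    exact refWord_le _
  · rcases le_or_gt t (beg T p + 2) with h2 | h2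
    · rw [(h.round_second p h1 h2).1]
      exact refWord_le _
    · rw [(h.round_third p h2).1]
      exact refWord_le _

theorem round_middle_cases (h : Inv T op m t σ) (p : Fin n) :
    rg (round (program out) T op m σ p) 7 =
      if t = beg T p + 2 then rg (σ p) 6 else rg (σ p) 7 := by
  rw [round_middle, if_congr (h.clock_eq_begin_iff p 2) rfl rfl]

theorem round_requester_iff (h : Inv T op m t σ) (p q : Fin n) :
    rg (round (program out) T op m σ p) 8 = q + 1 ↔ Requests T t q p := by
  rw [round_requester]
  by_cases hc : ∃ u, Comm T t 0 u p
  · obtain ⟨u, hu⟩ := hc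
    rw [h.inb_eq_some hu, Option.map_some, Option.getD_some, packet_zero_word]
    constructor
    · intro e
      have : u = q := Fin.ext (by omega)
      exact this ▸ hu
    · intro e
      have : u = q := hu.sender_unique (ch := 0) e
      rw [this]
  · rw [h.inb_eq_none fun u hu => hc ⟨u, hu⟩]
    simp only [Option.map_none, Option.getD_none]
    exact ⟨fun e => by omega, fun e => absurd ⟨q, e⟩ hc⟩

theorem round_reporter_iff (h : Inv T op m t σ) (p q : Fin n) :
    rg (round (program out) T op m σ p) 9 = q + 1 ↔
      t = trn n ∧ T.firstChild p = some q := by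
  rw [round_reporter]
  by_cases hc : ∃ u, Comm T t 2 u p
  · obtain ⟨u, hu⟩ := hc
    rw [h.inb_eq_some hu, Option.map_some, Option.getD_some, packet_two]
    constructor
    · intro e
      have : u = q := Fin.ext (by simp only at e; omega)
      exact this ▸ hu
    · intro e
      have : u = q := hu.sender_unique (ch := 2) e
      rw [this]
  · rw [h.inb_eq_none fun u hu => hc ⟨u, hu⟩]
    simp only [Option.map_none, Option.getD_none]
    exact ⟨fun e => by omega, fun e => absurd ⟨q, e⟩ hc⟩

theorem round_requester_le (h : Inv T op m t σ) (p : Fin n) :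
    rg (round (program out) T op m σ p) 8 ≤ n := by
  rw [round_requester]
  by_cases hc : ∃ u, Comm T t 0 u p
  · obtain ⟨u, hu⟩ := hc
    rw [h.inb_eq_some hu, Option.map_some, Option.getD_some, packet_zero_word]
    exact u.2
  · rw [h.inb_eq_none fun u hu => hc ⟨u, hu⟩]
    exact Nat.zero_le _

theorem round_reporter_le (h : Inv T op m t σ) (p : Fin n) :
    rg (round (program out) T op m σ p) 9 ≤ n := by
  rw [round_reporter]
  by_cases hc : ∃ u, Comm T t 2 u p
  · obtain ⟨u, hu⟩ := hc
    rw [h.inb_eq_some hu, Option.map_some, Option.getD_some, packet_two]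
    exact u.2
  · rw [h.inb_eq_none fun u hu => hc ⟨u, hu⟩]
    exact Nat.zero_le _

/-- The broadcast reaches a vertex only in round `trn n + 1 + T.dep p`: depth `0` is served by the
parent in `T`, depth `e + 1` by a sibling of depth `e`. -/
theorem round_broadcast_keep (h : Inv T op m t σ) (p : Fin n)
    (hp : p ≠ T.root → t ≠ trn n + 1 + T.dep p) :
    sl (round (program out) T op m σ p) 1 = sl (σ p) 1 := by
  have h3 : inb T op m σ p 3 = none := by
    refine h.inb_eq_none fun q hq => ?_
    have hr : p ≠ T.root := by
      apply T.ne_root_of_mem_kids (p := q)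
      rw [mem_kids]
      rcases hq with ⟨-, h⟩ | ⟨-, h⟩ <;> tauto
    have := hp hr
    rcases hq with ⟨h1, h2⟩ | ⟨h1, h2⟩
    · have := (firstChild_spec h2).2.2.2.1
      omega
    · have := (leftChild_spec h2).2.2.2.2
      omega
  have h4 : inb T op m σ p 4 = none := by
    refine h.inb_eq_none fun q hq => ?_
    have := hp (T.ne_root_of_mem_kids (p := q) (T.mem_kids.2 (Or.inr (Or.inr hq.2))))
    have := (rightChild_spec hq.2).2.2.2.2
    have := hq.1
    omega
  rw [round_broadcast, h3, h4]
  simp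

theorem reporter_eq_zero (h : Inv T op m t σ) (p : Fin n) (ht : t ≠ trn n + 1) :
    rg (σ p) 9 = 0 := by
  by_contra hc
  obtain ⟨u, hu⟩ := h.reporter_pos (v := p) (by omega)
  exact ht ((h.reporter p u).1 hu).1

/-- The slot is empty and just one of channels 3 and 4 delivers, so the merges never apply `op`. A
relaying sibling has the same parent in `T`, hence holds the right message. -/
theorem round_broadcast_arrive (h : Inv T op m t σ) {p : Fin n} (hp : p ≠ T.root)
    (ht : t = trn n + 1 + T.dep p) :
    sl (round (program out) T op m σ p) 1 = some (m (T.parent p)) := by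
  obtain ⟨q, hq⟩ := T.exists_mem_kids hp
  rw [round_broadcast, h.broadcast_none p (by omega), Option.merge_none_left]
  rw [mem_kids] at hq
  rcases hq with hq | hq | hq
  · obtain ⟨-, e2, -, e4, -⟩ := firstChild_spec hq
    have hc : Comm T t 3 q p := Or.inl ⟨by omega, hq⟩
    have h4 : inb T op m σ p 4 = none :=
      h.inb_eq_none fun u hu => firstChild_ne_rightChild hq hu.2
    have h9 := (h.reporter q p).2 ⟨by omega, hq⟩
    rw [h4, h.inb_eq_some hc, packet_three, if_neg (by omega),
      h.broadcast_none q (by omega), e2]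
    simp
  · obtain ⟨-, e2, -, -, e5⟩ := leftChild_spec hq
    have hc : Comm T t 3 q p := Or.inr ⟨by omega, hq⟩
    have h4 : inb T op m σ p 4 = none :=
      h.inb_eq_none fun u hu => leftChild_ne_rightChild hq hu.2
    obtain ⟨hr, he⟩ := T.parent_eq_of_sibs_eq hp e2
    rw [h4, h.inb_eq_some hc, packet_three, if_pos (h.reporter_eq_zero q (by omega)),
      h.broadcast_some q hr (by omega), he]
    simp
  · obtain ⟨-, e2, -, -, e5⟩ := rightChild_spec hq
    have hc : Comm T t 4 q p := ⟨by omega, hq⟩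
    have h3 : inb T op m σ p 3 = none := by
      refine h.inb_eq_none fun u hu => ?_
      rcases hu with ⟨-, hu⟩ | ⟨-, hu⟩
      · exact firstChild_ne_rightChild hu hq
      · exact leftChild_ne_rightChild hu hq
    obtain ⟨hr, he⟩ := T.parent_eq_of_sibs_eq hp e2
    rw [h3, h.inb_eq_some hc, packet_four, h.broadcast_some q hr (by omega), he]
    simp

theorem round_reduce_keep (h : Inv T op m t σ) (p : Fin n) (ht : t ≠ trn n) :
    sl (round (program out) T op m σ p) 2 = sl (σ p) 2 := by
  rw [round_reduce, h.inb_eq_none fun q (hq : Comm T t 2 q p) => ht hq.1]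
  simp

theorem round_reduce_arrive (h : Inv T op m t σ) (ho : Std.Associative op) (p : Fin n)
    (ht : t = trn n) :
    sl (round (program out) T op m σ p) 2 = T.localReduce op m p := by
  rw [round_reduce, h.reduce_none p ht.le, Option.merge_none_left]
  cases hq : T.firstChild p with
  | none =>
    rw [h.inb_eq_none fun q hc => by simpa [hq] using hc.2, localReduce_of_firstChild_eq_none hq]
    rfl
  | some q =>
    have hc : Comm T t 2 q p := ⟨ht, hq⟩
    rw [h.inb_eq_some hc, packet_two, Option.bind_some,
      -- Even blocks of depth `0` are complete after `5 * lv n + 5` rounds, before the reports.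
      h.acc_third ho q (by rw [ht, trn, beg]; omega), segment_firstChild hq]

theorem round (h : Inv T op m t σ) (ht : t < 6 * lv n + 11) :
    Inv T op m (t + 1) (round (program out) T op m σ) where
  clock v := by
    rw [round_clock, h.clock, h.levels, if_neg (by omega)]
  power v := by
    rw [round_power, h.power, if_congr (le_two_pow_sub_one_iff v.pos t) rfl rfl]
    split_ifs with h1
    · rw [min_eq_right h1, min_eq_right (by omega)]
    · rw [min_eq_left (by omega), min_eq_left (by omega), pow_succ]
      have := Nat.one_le_two_pow (n := t)
      omega
  levels v := by
    rw [round_levels, h.power, h.levels, if_congr (le_two_pow_sub_one_iff v.pos t) rfl rfl]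
    split_ifs <;> omega
  search _ v := by
    rcases Nat.eq_zero_or_pos t with h0 | h0
    · obtain ⟨h1, h2, h3⟩ := round_descend_zero σ (T := T) (op := op) (m := m) v
        (by rw [h.clock, h0])
      rw [h1, h2, h3, T.input_index_sub_one, T.input_degree, h0]
      rfl
    · rw [round_descend σ v (by rw [h.clock]; omega), h.search h0 v,
        ← Function.iterate_succ_apply' descend]
      congr 2
      omega
  next_first v _ h2 := (h.round_first v (by omega)).1
  next_second v h1 h2 := (h.round_second v (by omega) (by omega)).1
  next_third v h1 := (h.round_third v (by omega)).1
  next_le v := h.round_word_le v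
  middle v h1 := by
    rw [h.round_middle_cases]
    split_ifs with h2
    · exact h.next_second v (by omega) (by omega)
    · exact h.middle v (by omega)
  middle_le v := by
    rw [h.round_middle_cases]
    split_ifs
    · exact h.next_le v
    · exact h.middle_le v
  requester v u := by
    rw [h.round_requester_iff, Nat.add_sub_cancel]
    simp
  requester_le v := h.round_requester_le v
  reporter v u := by
    rw [h.round_reporter_iff, Nat.add_right_cancel_iff]
  reporter_le v := h.round_reporter_le v
  acc_zero h0 := by omega
  acc_first v _ h2 := (h.round_first v (by omega)).2
  acc_second ho v h1 h2 := (h.round_second v (by omega) (by omega)).2 ho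
  acc_third ho v h1 := (h.round_third v (by omega)).2 ho
  broadcast_none v hv := by
    rw [h.round_broadcast_keep v (by omega)]
    exact h.broadcast_none v (by omega)
  broadcast_some v hr hv := by
    by_cases h1 : t = trn n + 1 + T.dep v
    · exact h.round_broadcast_arrive hr h1
    · rw [h.round_broadcast_keep v fun _ => h1]
      exact h.broadcast_some v hr (by omega)
  reduce_none v hv := by
    rw [h.round_reduce_keep v (by omega)]
    exact h.reduce_none v (by omega)
  reduce_some ho v hv := by
    by_cases h1 : t = trn n
    · exact h.round_reduce_arrive ho v h1
    · rw [h.round_reduce_keep v h1]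
      exact h.reduce_some ho v (by omega)

end Inv

end LocalMessaging
end SpatialTree

/-! ### Halting and resource bounds -/

namespace SpatialTree
namespace LocalMessaging

open StoredTree

variable {n : ℕ} {T : StoredTree n} {out : Fin 3} {M : Type*} {op : M → M → M} {m : Fin n → M}

/-- The number of rounds of the program. -/
def rounds (n : ℕ) : ℕ := 6 * lv n + 11

theorem inv_state {t : ℕ} (ht : t ≤ rounds n) :
    Inv T op m t (state (program out) T op m t) := by
  induction t with
  | zero => exact inv_zero
  | succ t ih => exact (ih (by omega)).round ht

theorem sends_iff {t : ℕ} (ht : t ≤ rounds n) (p q : Fin n) (ch : Fin 5) :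
    Sends (program out) T op m t p ch q ↔ Comm T t ch p q :=
  (inv_state ht).recipient_iff p q ch

theorem not_comm_rounds (p q : Fin n) (ch : Fin 5) : ¬ Comm T (rounds n) ch p q := by
  intro h
  have := h.lt
  unfold rounds at this
  omega

/-- No packet arrives any more, the clock has stopped, the search is at its fixed point, and the
registers for requests and reports are already `0`. -/
theorem Inv.round_eq_self {σ : Fin n → Mem (program out) M} (h : Inv T op m (rounds n) σ) :
    SpatialTree.round (program out) T op m σ = σ := by
  have hi : ∀ q ch, inb T op m σ q ch = none := fun q ch =>
    h.inb_eq_none fun p => not_comm_rounds p q ch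
  have hlv : lv n < rounds n := by unfold rounds; omega
  funext v
  have hc : rg (σ v) 0 ≠ 0 := by rw [h.clock]; omega
  have hn := v.pos
  have hpow : n ≤ rg (σ v) 1 := by
    rw [h.power, le_two_pow_sub_one_iff hn]
    exact hlv.le
  obtain ⟨s1, s2, s3⟩ := h.settled hlv v
  have hd := round_descend σ (T := T) (op := op) (m := m) v hc
  have hd' : descend (rg (σ v) 3, rg (σ v) 4, rg (σ v) 5) =
      (rg (σ v) 3, rg (σ v) 4, rg (σ v) 5) := by
    rw [s1]
    rfl
  rw [hd'] at hd
  simp only [Prod.mk.injEq] at hd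
  have hreg : ∀ i : Fin 10, rg (SpatialTree.round (program out) T op m σ v) i = rg (σ v) i := by
    intro i
    match i with
    | 0 =>
      rw [round_clock, if_pos]
      rw [h.clock, h.levels, min_eq_right hlv.le]
      exact le_rfl
    | 1 => rw [round_power, if_pos hpow]
    | 2 => rw [round_levels, if_pos hpow]
    | 3 => exact hd.1
    | 4 => exact hd.2.1
    | 5 => exact hd.2.2
    | 6 => exact round_next_none σ v hc (hi v 1)
    | 7 =>
      rw [h.round_middle_cases, if_neg]
      unfold rounds beg
      omega
    | 8 =>
      rw [round_requester, hi]
      by_contra h0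
      obtain ⟨u, hu⟩ := h.requester_pos (v := v) (Nat.pos_of_ne_zero (Ne.symm h0))
      have := ((h.requester v u).1 hu).2.lt
      unfold rounds at this
      omega
    | 9 =>
      rw [round_reporter, hi, h.reporter_eq_zero v (by unfold rounds trn; omega)]
      rfl
  have hslot : ∀ i : Fin 3, sl (SpatialTree.round (program out) T op m σ v) i = sl (σ v) i := by
    intro i
    match i with
    | 0 => rw [round_acc σ v hc, hi]; simp
    | 1 => rw [round_broadcast, hi, hi]; simp
    | 2 => rw [round_reduce, hi]; simp
  exact Mem.ext (funext hreg) (funext hslot)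

theorem rg_le {t : ℕ} (ht : t ≤ rounds n) (v : Fin n) (i : Fin 10) :
    rg (state (program out) T op m t v) i ≤ 32 * (n + 1) := by
  have h := inv_state (T := T) (op := op) (m := m) (out := out) ht
  have hn := v.pos
  have hlog : Nat.log 2 n < n := Nat.log_lt_self 2 hn.ne'
  have hsearch : rg (state (program out) T op m t v) 3 ≤ n ∧
      rg (state (program out) T op m t v) 4 ≤ n ∧
      rg (state (program out) T op m t v) 5 ≤ n := by
    rcases Nat.eq_zero_or_pos t with rfl | h0
    · exact ⟨Nat.zero_le _, Nat.zero_le _, Nat.zero_le _⟩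
    · have h1 := h.search h0 v
      obtain ⟨x, r, e, h2, h3, h4, h5, -⟩ := exists_block_descend (T.idx_lt v) (t - 1)
      rw [h2] at h1
      simp only [Prod.mk.injEq] at h1
      have h6 := h5.add_le
      have h7 := h5.depth_lt
      have h8 := T.length_sibs_le v
      have h9 := T.idx_lt v
      omega
  match i with
  | 0 =>
    rw [h.clock]
    unfold rounds lv at ht
    omega
  | 1 =>
    have h1 : 2 ^ min t (lv n) ≤ 2 ^ (Nat.log 2 n + 1) :=
      Nat.pow_le_pow_right (by omega) (min_le_right _ _)
    have h2 := Nat.pow_log_le_self 2 hn.ne'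
    rw [h.power]
    rw [pow_succ] at h1
    omega
  | 2 =>
    rw [h.levels]
    unfold lv
    omega
  | 3 => have := hsearch.1; omega
  | 4 => have := hsearch.2.1; omega
  | 5 => have := hsearch.2.2; omega
  | 6 => have := h.next_le v; omega
  | 7 => have := h.middle_le v; omega
  | 8 => have := h.requester_le v; omega
  | 9 => have := h.reporter_le v; omega

theorem word_le {t : ℕ} (ht : t ≤ rounds n) (p : Fin n) (ch : Fin 5) :
    (pk T op m (state (program out) T op m t) p ch).word ≤ 32 * (n + 1) := by
  have hp := p.2
  match ch with
  | 0 => rw [packet_zero_word]; omega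
  | 1 => rw [packet_one]; exact rg_le ht p 6
  | 2 => rw [packet_two]; simp only; omega
  | 3 => rw [packet_three]; exact Nat.zero_le _
  | 4 => rw [packet_four]; exact Nat.zero_le _

end LocalMessaging

/-- The packets of a chain are sent in distinct rounds, so the depth bound follows from the bound on
rounds. -/
theorem chainLength_le {n : ℕ} (P : Program) (T : StoredTree n) {M : Type*} (op : M → M → M)
    (m : Fin n → M) (t : ℕ) (q : Fin n) : chainLength P T op m t q ≤ t := by
  induction t generalizing q with
  | zero => exact le_rfl
  | succ t ih =>
    refine max_le ((ih q).trans (Nat.le_succ t)) (Finset.sup_le fun p _ => ?_)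
    split_ifs
    · exact Nat.succ_le_succ (ih p)
    · exact Nat.zero_le _

theorem sum_ite_le_of_unique {s : Finset ℕ} {P : ℕ → Prop} [DecidablePred P] {Q : Prop}
    [Decidable Q] (hQ : ∀ i ∈ s, P i → Q) (hu : ∀ i ∈ s, ∀ j ∈ s, P i → P j → i = j) (d : ℕ) :
    ∑ i ∈ s, (if P i then d else 0) ≤ if Q then d else 0 := by
  rw [← Finset.sum_filter, Finset.sum_const, smul_eq_mul]
  have hcard : (s.filter P).card ≤ 1 := Finset.card_le_one.2 fun i hi j hj =>
    hu i (Finset.mem_filter.1 hi).1 j (Finset.mem_filter.1 hj).1 (Finset.mem_filter.1 hi).2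
      (Finset.mem_filter.1 hj).2
  split_ifs with h
  · exact (Nat.mul_le_mul_right d hcard).trans (one_mul d).le
  · have : s.filter P = ∅ := Finset.filter_eq_empty_iff.2 fun i hi hp => h (hQ i hi hp)
    simp [this]

/-- The energy of an execution that uses every edge of the virtual tree at most once per
channel and direction. -/
theorem energy_le_of_kids {n : ℕ} (P : Program) (T : StoredTree n) {M : Type*}
    (op : M → M → M) (m : Fin n → M) (K : Curve) (t : ℕ)
    (hk : ∀ i < t, ∀ p ch q, Sends P T op m i p ch q → q ∈ T.kids p ∨ p ∈ T.kids q)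
    (hu : ∀ i < t, ∀ j < t, ∀ p ch q, Sends P T op m i p ch q → Sends P T op m j p ch q →
      i = j) :
    energy P T op m K t ≤
      2 * P.channels * ∑ p : Fin n, ∑ q : Fin n, if q ∈ T.kids p then K.dist p q else 0 := by
  calc energy P T op m K t
      = ∑ p : Fin n, ∑ ch : Fin P.channels, ∑ q : Fin n, ∑ i ∈ Finset.range t,
          if Sends P T op m i p ch q then K.dist p q else 0 := by
        unfold energy
        -- With the sum over rounds innermost, each channel from `p` to `q` contributes its distance
        -- at most once.
        rw [Finset.sum_comm]
        refine Finset.sum_congr rfl fun p _ => ?_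
        rw [Finset.sum_comm]
        exact Finset.sum_congr rfl fun ch _ => Finset.sum_comm
    _ ≤ ∑ p : Fin n, ∑ _ch : Fin P.channels, ∑ q : Fin n,
          ((if q ∈ T.kids p then K.dist p q else 0) +
            if p ∈ T.kids q then K.dist q p else 0) := by
        refine Finset.sum_le_sum fun p _ => Finset.sum_le_sum fun ch _ =>
          Finset.sum_le_sum fun q _ => ?_
        refine (sum_ite_le_of_unique (Q := q ∈ T.kids p ∨ p ∈ T.kids q)
          (fun i hi => hk i (Finset.mem_range.1 hi) p ch q)
          (fun i hi j hj => hu i (Finset.mem_range.1 hi) j (Finset.mem_range.1 hj) p ch q)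
          _).trans ?_
        rw [K.dist_comm q p]
        by_cases h1 : q ∈ T.kids p <;> by_cases h2 : p ∈ T.kids q <;> simp [h1, h2]
    _ = 2 * P.channels * ∑ p : Fin n, ∑ q : Fin n,
          if q ∈ T.kids p then K.dist p q else 0 := by
        simp only [Finset.sum_add_distrib, Finset.sum_const, Finset.card_univ, Fintype.card_fin,
          smul_eq_mul]
        rw [← Finset.mul_sum, ← Finset.mul_sum,
          Finset.sum_comm (f := fun p q : Fin n => if p ∈ T.kids q then K.dist q p else 0)]
        ring

namespace LocalMessaging

open StoredTree

/-- In the constant, `10` is five channels times two directions; `20` covers the at most `17 * lv n`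
rounds and the exponent `6` needed for words. -/
theorem haltsWithin {n : ℕ} (T : StoredTree n) {out : Fin 3} {M : Type*} (op : M → M → M)
    (m : Fin n → M) (K : Curve) {C : ℕ}
    (hC : ∑ p : Fin n, ∑ q : Fin n, (if q ∈ T.kids p then K.dist p q else 0) ≤ C * n) :
    HaltsWithin (program out) T op m K (10 * C + 20) (rounds n) := by
  have hr : rounds n ≤ (10 * C + 20) * (Nat.log 2 n + 1) := by
    have : 20 * (Nat.log 2 n + 1) ≤ (10 * C + 20) * (Nat.log 2 n + 1) :=
      Nat.mul_le_mul_right _ (by omega)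
    unfold rounds lv
    omega
  have hw : n ≠ 0 → 32 * (n + 1) ≤ (n + 1) ^ (10 * C + 20) := by
    intro hn
    calc 32 * (n + 1) = 2 ^ 5 * (n + 1) := by norm_num
      -- Here `2 ≤ n + 1` is needed; for `n = 0` there is no processor whose words need a bound.
      _ ≤ (n + 1) ^ 5 * (n + 1) := Nat.mul_le_mul_right _ (Nat.pow_le_pow_left (by omega) 5)
      _ = (n + 1) ^ 6 := (pow_succ _ _).symm
      _ ≤ (n + 1) ^ (10 * C + 20) := Nat.pow_le_pow_right (by omega) (by omega)
  refine ⟨?_, ?_, ?_, ?_, ?_, hr, ?_, ?_⟩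
  · intro i hi p p' ch q h h'
    exact ((sends_iff hi.le p q ch).1 h).sender_unique ((sends_iff hi.le p' q ch).1 h')
  · intro p ch q h
    exact not_comm_rounds p q ch ((sends_iff le_rfl p q ch).1 h)
  · exact (inv_state le_rfl).round_eq_self
  · refine (energy_le_of_kids (program out) T op m K (rounds n) ?_ ?_).trans ?_
    · intro i hi p ch q h
      exact ((sends_iff hi.le p q ch).1 h).kids
    · intro i hi j hj p ch q h h'
      exact ((sends_iff hi.le p q ch).1 h).time_unique ((sends_iff hj.le p q ch).1 h')
    · calc 2 * 5 * ∑ p : Fin n, ∑ q : Fin n, (if q ∈ T.kids p then K.dist p q else 0)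
          ≤ 2 * 5 * (C * n) := Nat.mul_le_mul_left _ hC
        _ = 10 * C * n := by ring
        _ ≤ (10 * C + 20) * n := Nat.mul_le_mul_right _ (by omega)
  · exact (Finset.sup_le fun q _ => chainLength_le _ T op m _ q).trans hr
  · intro i hi p r
    exact (rg_le hi p r).trans (hw p.pos.ne')
  · intro i hi p ch q _
    exact (word_le hi.le p ch).trans (hw p.pos.ne')

end LocalMessaging
end SpatialTree

theorem mainTheorem3 :
    ∃ broadcast reduce : SpatialTree.Program,
      ∀ K : SpatialTree.Curve, K.EnergyBound →
        ∃ C : ℕ, ∀ (n : ℕ) (T : SpatialTree.StoredTree n), T.LightFirst →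
          ∀ (M : Type*) (op : M → M → M) (m : Fin n → M),
            (∃ t : ℕ, SpatialTree.HaltsWithin broadcast T op m K C t ∧
              ∀ v : Fin n, v ≠ T.root →
                SpatialTree.output broadcast T op m t v = some (m (T.parent v))) ∧
            (Std.Associative op →
              ∃ t : ℕ, SpatialTree.HaltsWithin reduce T op m K C t ∧
                ∀ v : Fin n,
                  SpatialTree.output reduce T op m t v = T.localReduce op m v) := by
  open SpatialTree LocalMessaging in
  -- Slot 1 collects the broadcast and slot 2 the report of the first child; both programs run the
  -- same execution.
  refine ⟨program 1, program 2, fun K hK => ?_⟩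
  obtain ⟨C, hC⟩ := hK.exists_virtual_bound
  refine ⟨10 * C + 20, fun n T hT M op m => ⟨?_, fun ho => ?_⟩⟩
  · refine ⟨rounds n, haltsWithin T op m K (hC n T hT), fun v hv => ?_⟩
    have := dep_lt_lv T v
    exact (inv_state le_rfl).broadcast_some v hv (by unfold trn rounds; omega)
  · refine ⟨rounds n, haltsWithin T op m K (hC n T hT), fun v => ?_⟩
    exact (inv_state le_rfl).reduce_some ho v (by unfold trn rounds; omega)
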